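/- Let $n\ge 0$ be an integer and let $\widehat T\subset\mathbb R^2$ be the closed triangle with vertices $(0,0),(1,0),(0,1)$. Let $\mathbb P_{n,n-1}^{\perp}(\widehat T)$ be the space of real polynomials $u(x_1,x_2)$ of total degree at most $n$ with $\int_{\widehat T}uv=0$ for every polynomial $v$ of total degree at most $n-1$ (no orthogonality condition if $n=0$). For $0\le k\le n$ put $$b_{n,k}(x_1,x_2)=(x_1+x_2)^k\,P_{n-k}^{(0,2k+1)}\bigl(2(x_1+x_2)-1\bigr)\,P_k^{(0,0)}\!\left(\frac{x_1-x_2}{x_1+x_2}\right),$$ where $$P_m^{(\alpha,\beta)}(x)=\frac{(\alpha+1)_m}{m!}\sum_{i=0}^m\frac{(-m)_i\,(m+\alpha+\beta+1)_i}{(\alpha+1)_i\,i!}\left(\frac{1-x}{2}\right)^i$$ are the Jacobi polynomials and $(a)_i=a(a+1)\cdots(a+i-1)$. Define linear operators on polynomials by $(Mp)(x_1,x_2)=p(1-x_1-x_2,x_2)$ and $(Rp)(x_1,x_2)=p(x_2,x_1)$, and set $\Pi=\frac13(2I-MR-RM)$. The operators $M,R$ generate an action of the symmetric group $\mathcal S_3$,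 which preserves $\mathbb P_{n,n-1}^{\perp}(\widehat T)$. Let $\tau_{\mathrm{refl}}$ be the two-dimensional irreducible (reflection) representation of $\mathcal S_3$, given by $$R\mapsto\begin{pmatrix}-1&0\\0&1\end{pmatrix},\qquad M\mapsto\begin{pmatrix}1/2&1\\3/4&-1/2\end{pmatrix}.$$ The $\tau_{\mathrm{refl}}$ component of $\mathbb P_{n,n-1}^{\perp}(\widehat T)$ is the sum of all its $\mathcal S_3$-submodules isomorphic to $\tau_{\mathrm{refl}}$. (a) The polynomials $\Pi b_{n,2k}$, for integers $0\le k\le\frac{n-1}{3}$, are linearly independent. (b) The polynomials $RM\Pi b_{n,2k}$ and $MR\Pi b_{n,2k}$, for integers $0\le k\le\frac{n-1}{3}$, are (all together) linearly independent, and they form a basis of the $\tau_{\mathrm{refl}}$ component of $\mathbb P_{n,n-1}^{\perp}(\widehat T)$. -/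

import Mathlib

namespace TriangleOP

noncomputable section

/-- Real polynomials in the two variables `x₁ = X 0` and `x₂ = X 1`. -/
abbrev Poly2 : Type := MvPolynomial (Fin 2) ℝ

/-- The closed unit triangle with vertices `(0,0)`, `(1,0)`, `(0,1)`. -/
def refTriangle : Set (Fin 2 → ℝ) :=
  {x | 0 ≤ x 0 ∧ 0 ≤ x 1 ∧ x 0 + x 1 ≤ 1}

theorem isCompact_refTriangle : IsCompact refTriangle := by
  apply (isCompact_Icc (a := (0 : Fin 2 → ℝ)) (b := 1)).of_isClosed_subset
  · have h0 : IsClosed {x : Fin 2 → ℝ | 0 ≤ x 0} := isClosed_le (by fun_prop) (by fun_prop)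
    have h1 : IsClosed {x : Fin 2 → ℝ | 0 ≤ x 1} := isClosed_le (by fun_prop) (by fun_prop)
    have h2 : IsClosed {x : Fin 2 → ℝ | x 0 + x 1 ≤ 1} := isClosed_le (by fun_prop) (by fun_prop)
    exact h0.inter (h1.inter h2)
  · rintro x ⟨h0, h1, h2⟩
    refine ⟨fun i => ?_, fun i => ?_⟩ <;> fin_cases i <;> simp <;> linarith

theorem integrableOn_eval (p : Poly2) :
    MeasureTheory.IntegrableOn (fun x => MvPolynomial.eval x p) refTriangle :=
  (MvPolynomial.continuous_eval p).continuousOn.integrableOn_compact isCompact_refTriangle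

/-- The `L²` pairing `∫ u v` over the unit triangle (Lebesgue measure). -/
def triangleInner (u v : Poly2) : ℝ :=
  ∫ x in refTriangle, MvPolynomial.eval x u * MvPolynomial.eval x v

/-- The polynomials of total degree at most `n` that are orthogonal on the triangle to every
polynomial of total degree less than `n` (there is no orthogonality condition on `u` if `n = 0`:
the only polynomial of degree less than `0` is the zero polynomial). -/
def orthPoly (n : ℕ) : Submodule ℝ Poly2 where
  carrier := {u | u.totalDegree ≤ n ∧
    ∀ v : Poly2, 1 ≤ n → v.totalDegree ≤ n - 1 → triangleInner u v = 0}
  zero_mem' := by simp [triangleInner]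
  add_mem' := by
    rintro u w ⟨hu, hu'⟩ ⟨hw, hw'⟩
    refine ⟨(MvPolynomial.totalDegree_add u w).trans (max_le hu hw), fun v hn hv => ?_⟩
    have h1 := hu' v hn hv
    have h2 := hw' v hn hv
    have i1 := integrableOn_eval (u * v)
    have i2 := integrableOn_eval (w * v)
    simp only [map_mul] at i1 i2
    simp only [triangleInner, map_add, add_mul] at h1 h2 ⊢
    rw [MeasureTheory.integral_add i1 i2, h1, h2, add_zero]
  smul_mem' := by
    rintro c u ⟨hu, hu'⟩
    refine ⟨(MvPolynomial.totalDegree_smul_le c u).trans hu, fun v hn hv => ?_⟩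
    have h1 := hu' v hn hv
    simp only [triangleInner, MvPolynomial.smul_eval, mul_assoc] at h1 ⊢
    rw [MeasureTheory.integral_const_mul, h1, mul_zero]

/-- The shifted factorial `(a)_m = a (a + 1) ⋯ (a + m - 1)`. -/
def shiftedFactorial (a : ℝ) (m : ℕ) : ℝ := ∏ i ∈ Finset.range m, (a + i)

/-- The Jacobi polynomial
`P_m^{(α,β)}(x) = (α+1)_m / m! * ₂F₁(-m, m+α+β+1; α+1; (1-x)/2)`, for `α, β > -1`. -/
def jacobi (α β : ℝ) (m : ℕ) : Polynomial ℝ :=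
  Polynomial.C (shiftedFactorial (α + 1) m / (m.factorial : ℝ)) *
    ∑ i ∈ Finset.range (m + 1),
      Polynomial.C (shiftedFactorial (-(m : ℝ)) i * shiftedFactorial ((m : ℝ) + α + β + 1) i /
          (shiftedFactorial (α + 1) i * (i.factorial : ℝ))) *
        (Polynomial.C (1 / 2 : ℝ) * (1 - Polynomial.X)) ^ i

theorem natDegree_jacobi_le (α β : ℝ) (m : ℕ) : (jacobi α β m).natDegree ≤ m := by
  refine (Polynomial.natDegree_C_mul_le _ _).trans (Polynomial.natDegree_sum_le_of_forall_le _ _ ?_)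
  intro i hi
  refine (Polynomial.natDegree_C_mul_le _ _).trans (Polynomial.natDegree_pow_le.trans ?_)
  have h : (Polynomial.C (1 / 2 : ℝ) * (1 - Polynomial.X)).natDegree ≤ 1 := by
    refine (Polynomial.natDegree_C_mul_le _ _).trans ((Polynomial.natDegree_sub_le _ _).trans ?_)
    simp
  have := Finset.mem_range.1 hi
  nlinarith

/-- The basis polynomials, for `k ≤ n`,
`b_{n,k}(x₁,x₂) = (x₁+x₂)^k P_{n-k}^{(0,2k+1)}(2(x₁+x₂)-1) P_k^{(0,0)}((x₁-x₂)/(x₁+x₂))`.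
The factor `(x₁+x₂)^k P_k^{(0,0)}((x₁-x₂)/(x₁+x₂))` is written out as a polynomial. -/
def bPoly (n k : ℕ) : Poly2 :=
  Polynomial.aeval (2 * (MvPolynomial.X 0 + MvPolynomial.X 1) - 1 : Poly2)
      (jacobi 0 (2 * (k : ℝ) + 1) (n - k)) *
    ∑ i ∈ Finset.range (k + 1),
      MvPolynomial.C ((jacobi 0 0 k).coeff i) *
        (MvPolynomial.X 0 - MvPolynomial.X 1) ^ i *
        (MvPolynomial.X 0 + MvPolynomial.X 1) ^ (k - i)

/-- `bPoly` takes the values given by the defining formula of `b_{n,k}`. -/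
theorem eval_bPoly (n k : ℕ) (x : Fin 2 → ℝ) (hx : x 0 + x 1 ≠ 0) :
    MvPolynomial.eval x (bPoly n k) =
      (x 0 + x 1) ^ k * (jacobi 0 (2 * (k : ℝ) + 1) (n - k)).eval (2 * (x 0 + x 1) - 1) *
        (jacobi 0 0 k).eval ((x 0 - x 1) / (x 0 + x 1)) := by
  have h1 : ∀ p : Polynomial ℝ, MvPolynomial.eval x (Polynomial.aeval
      (2 * (MvPolynomial.X 0 + MvPolynomial.X 1) - 1 : Poly2) p) =
      p.eval (2 * (x 0 + x 1) - 1) := by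
    intro p
    have := Polynomial.aeval_algHom_apply (MvPolynomial.aeval x : Poly2 →ₐ[ℝ] ℝ)
      (2 * (MvPolynomial.X 0 + MvPolynomial.X 1) - 1 : Poly2) p
    rw [← MvPolynomial.coe_aeval_eq_eval]
    refine this.symm.trans ?_
    rw [Polynomial.aeval_def, Polynomial.eval₂_eq_eval_map]
    simp
  rw [bPoly, map_mul, h1, Polynomial.eval_eq_sum_range'
    (Nat.lt_succ_of_le (natDegree_jacobi_le 0 0 k)) ((x 0 - x 1) / (x 0 + x 1)),
    mul_comm ((x 0 + x 1) ^ k), mul_assoc, Finset.mul_sum, map_sum]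
  congr 1
  refine Finset.sum_congr rfl fun i hi => ?_
  have hik : i ≤ k := Nat.lt_succ_iff.1 (Finset.mem_range.1 hi)
  simp only [map_mul, map_pow, map_sub, map_add, MvPolynomial.eval_X, MvPolynomial.eval_C]
  rw [div_pow, pow_sub₀ _ hx hik]
  field_simp

/-- `(M p)(x₁,x₂) = p(1 - x₁ - x₂, x₂)`. -/
def opM : Poly2 →ₗ[ℝ] Poly2 :=
  (MvPolynomial.aeval
    ![1 - MvPolynomial.X 0 - MvPolynomial.X 1, MvPolynomial.X 1] : Poly2 →ₐ[ℝ] Poly2).toLinearMap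

/-- `(R p)(x₁,x₂) = p(x₂, x₁)`. -/
def opR : Poly2 →ₗ[ℝ] Poly2 :=
  (MvPolynomial.aeval
    ![MvPolynomial.X 1, MvPolynomial.X 0] : Poly2 →ₐ[ℝ] Poly2).toLinearMap

/-- `Π = (2 I - M R - R M) / 3`; `*` is composition of operators. -/
def opPi : Poly2 →ₗ[ℝ] Poly2 :=
  (1 / 3 : ℝ) • ((2 : ℝ) • (1 : Module.End ℝ Poly2) - opM * opR - opR * opM)

/-- The matrix by which the reflection `(x₁,x₂) ↦ (x₂,x₁)` acts in the reflection
representation of the symmetric group `S₃`. -/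
def sigma1 : Matrix (Fin 2) (Fin 2) ℝ := !![-1, 0; 0, 1]

/-- The matrix by which the reflection `(x₁,x₂) ↦ (1 - x₁ - x₂,x₂)` acts in the reflection
representation of the symmetric group `S₃`. -/
def sigma2 : Matrix (Fin 2) (Fin 2) ℝ := !![1 / 2, 1; 3 / 4, -1 / 2]

/-- The operators `R`, `M` satisfy the defining relations of `S₃` in terms of two generating
reflections, so they define an action of `S₃` on polynomials. -/
theorem opR_opM_relations : opR * opR = 1 ∧ opM * opM = 1 ∧ (opM * opR) ^ 3 = 1 := by
  have key : ∀ f : Poly2 →ₐ[ℝ] Poly2,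
      f (MvPolynomial.X 0) = MvPolynomial.X 0 → f (MvPolynomial.X 1) = MvPolynomial.X 1 →
      f.toLinearMap = 1 := by
    intro f h0 h1
    have : f = AlgHom.id ℝ _ := by
      ext i : 1
      fin_cases i
      · exact h0
      · exact h1
    rw [this]
    rfl
  let R' : Poly2 →ₐ[ℝ] Poly2 := MvPolynomial.aeval ![MvPolynomial.X 1, MvPolynomial.X 0]
  let M' : Poly2 →ₐ[ℝ] Poly2 :=
    MvPolynomial.aeval ![1 - MvPolynomial.X 0 - MvPolynomial.X 1, MvPolynomial.X 1]
  refine ⟨(?_ : (R'.comp R').toLinearMap = 1), (?_ : (M'.comp M').toLinearMap = 1), ?_⟩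
  · apply key <;> simp [R']
  · apply key
    · simp [M']
      ring
    · simp [M']
  · have : (opM * opR) ^ 3 = ((M'.comp R').comp ((M'.comp R').comp (M'.comp R'))).toLinearMap := by
      rw [pow_succ', pow_two]
      rfl
    rw [this]
    apply key <;> simp [M', R']

/-- The matrices of the reflection representation satisfy the same relations. -/
theorem sigma_relations :
    sigma1 * sigma1 = 1 ∧ sigma2 * sigma2 = 1 ∧ (sigma2 * sigma1) ^ 3 = 1 := by
  refine ⟨?_, ?_, ?_⟩
  · ext i j; fin_cases i <;> fin_cases j <;> norm_num [sigma1, Matrix.mul_apply, Fin.sum_univ_two]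
  · ext i j; fin_cases i <;> fin_cases j <;> norm_num [sigma2, Matrix.mul_apply, Fin.sum_univ_two]
  · ext i j
    fin_cases i <;> fin_cases j <;>
      norm_num [sigma1, sigma2, pow_succ, Matrix.mul_apply, Fin.sum_univ_two]

/-- `E` is an `S₃`-submodule which realizes the reflection representation: it is isomorphic to `ℝ²`
with `R` acting by `σ₁` and `M` acting by `σ₂` (in particular `E` is stable under `R` and `M`,
which generate the group). -/
def RealizesRefl (E : Submodule ℝ Poly2) : Prop :=
  ∃ e : (Fin 2 → ℝ) ≃ₗ[ℝ] E, ∀ v : Fin 2 → ℝ,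
    opR (e v : Poly2) = (e (sigma1.mulVec v) : Poly2) ∧
    opM (e v : Poly2) = (e (sigma2.mulVec v) : Poly2)

/-- The reflection component (isotypic component of the reflection representation) of the space of
orthogonal polynomials of degree `n`: the sum of all its `S₃`-submodules that realize the
reflection representation. -/
def reflComponent (n : ℕ) : Submodule ℝ Poly2 :=
  sSup {E : Submodule ℝ Poly2 | E ≤ orthPoly n ∧ RealizesRefl E}

end

end TriangleOP

/-! An orthogonal polynomial of degree `n` is determined by its leading form: if the form vanishes,
the polynomial has lower degree and is orthogonal to itself (`eq_zero_of_mem_orthPoly`). Taking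
leading forms turns `opM` into its linear part `linM` and keeps `opR`, so everything can be tested
on forms, and a form is determined by its restriction to the line `x₁ + x₂ = 1`. With `t = x₁ - x₂`
on that line, the leading form of `b_{n,k}` becomes a nonzero multiple of the Legendre polynomial
`P_k(t)`, and `R` becomes `t ↦ -t`.

Independence of `Π b_{n,2k}`: an `R`-invariant `f` with `Π f = 0` is also `M`-invariant. If `f`
combines the `b_{n,2k}` with `k ≤ K = ⌊(n-1)/3⌋`, its leading form is divisible by `(x₁+x₂)^m`, `m =
n - 2K`, hence by symmetry also by `x₁^m` and `x₂^m`. On the line it is then a multiple of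
`(1-t²)^m` of degree at most `2K < 2m`, so it vanishes, and Legendre independence kills the
coefficients (`linearIndependent_opPi_bPoly`).

Spanning: for `3j ≥ n` and `2j ≤ n`, a product of the quadratic and the cubic `S₃`-invariant is an
invariant form of degree `n` restricting to degree `2j` on the line. Together with the `b_{n,2j}`,
`3j < n`, these fill all even degrees up to `n`. An `R`-invariant `w` is therefore a combination `b`
of the latter plus an invariant polynomial, which `Π` kills. If `Π w = w`, then `w = Π b`
(`mem_span_opPi_bPoly`).

Each copy of the reflection representation is generated by an `R`-fixed `w` with `w + Mw + RMw = 0`,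
and such `w` satisfy `Π w = w`. The copy is spanned by `RMw` and `MRw = Mw`, which yields the basis
in (b). -/

namespace TriangleOP

/-! ### Jacobi polynomials with first parameter 0 and natural second parameter; Legendre parity -/

open Polynomial in
/-- The polynomial `∑ (-1)^i C(m,i) C(m+β+i,i) y^i`, which is `P_m^{(0,β)}(1 - 2 y)`. -/
noncomputable def jacobiAux (β m : ℕ) : ℝ[X] :=
  ∑ i ∈ Finset.range (m + 1),
    C ((-1 : ℝ) ^ i * m.choose i * (m + β + i).choose i) * X ^ i

theorem shiftedFactorial_one (i : ℕ) : shiftedFactorial (0 + 1) i = (i.factorial : ℝ) := by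
  induction i with
  | zero => simp [shiftedFactorial]
  | succ i ih =>
    rw [shiftedFactorial, Finset.prod_range_succ, ← shiftedFactorial, ih, Nat.factorial_succ]
    push_cast
    ring

theorem shiftedFactorial_neg (m i : ℕ) :
    shiftedFactorial (-(m : ℝ)) i = (-1) ^ i * (i.factorial : ℝ) * m.choose i := by
  induction i with
  | zero => simp [shiftedFactorial]
  | succ i ih =>
    rw [shiftedFactorial, Finset.prod_range_succ, ← shiftedFactorial, ih, Nat.factorial_succ]
    have h : ((m.choose (i + 1) : ℕ) : ℝ) * (i + 1) = m.choose i * (m - i) := by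
      rcases le_or_gt i m with him | him
      · have := Nat.choose_succ_right_eq m i
        rw [← Nat.cast_sub him]
        exact_mod_cast this
      · simp [Nat.choose_eq_zero_of_lt him, Nat.choose_eq_zero_of_lt (him.trans (Nat.lt_succ_self i))]
    push_cast
    linear_combination (-1) ^ i * (i.factorial : ℝ) * h

theorem shiftedFactorial_succ_natCast (a i : ℕ) :
    shiftedFactorial ((a : ℝ) + 1) i = (i.factorial : ℝ) * (a + i).choose i := by
  induction i with
  | zero => simp [shiftedFactorial]
  | succ i ih =>
    rw [shiftedFactorial, Finset.prod_range_succ, ← shiftedFactorial, ih, Nat.factorial_succ]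
    have h : (((a + (i + 1)).choose (i + 1) : ℕ) : ℝ) * (i + 1) =
        (a + i + 1) * (a + i).choose i := by
      have := Nat.add_one_mul_choose_eq (a + i) i
      rw [← add_assoc]
      exact_mod_cast this.symm
    push_cast
    linear_combination -(i.factorial : ℝ) * h

/-- For natural `β` all three shifted factorials are factorials times binomial coefficients, so the
hypergeometric sum becomes a binomial sum in `y = (1 - x)/2`. -/
theorem jacobi_eq_comp (β m : ℕ) :
    jacobi 0 β m =
      (jacobiAux β m).comp (Polynomial.C (1 / 2 : ℝ) * (1 - Polynomial.X)) := by
  have hm : (m.factorial : ℝ) ≠ 0 := by positivity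
  rw [jacobi, jacobiAux, shiftedFactorial_one, div_self hm, map_one, one_mul,
    Polynomial.sum_comp]
  refine Finset.sum_congr rfl fun i _ => ?_
  have hi : (i.factorial : ℝ) ≠ 0 := by positivity
  have h : (m : ℝ) + 0 + (β : ℝ) + 1 = ((m + β : ℕ) : ℝ) + 1 := by push_cast; ring
  rw [shiftedFactorial_one, h, shiftedFactorial_neg, shiftedFactorial_succ_natCast,
    Polynomial.mul_comp, Polynomial.C_comp, Polynomial.X_pow_comp]
  congr 2
  field_simp

theorem natDegree_jacobiAux_le (β m : ℕ) : (jacobiAux β m).natDegree ≤ m := by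
  refine Polynomial.natDegree_sum_le_of_forall_le _ _ fun i hi => ?_
  exact (Polynomial.natDegree_C_mul_X_pow_le _ _).trans (Nat.lt_succ_iff.1 (Finset.mem_range.1 hi))

theorem coeff_jacobiAux_self_ne_zero (β m : ℕ) : (jacobiAux β m).coeff m ≠ 0 := by
  have : (jacobiAux β m).coeff m = (-1 : ℝ) ^ m * (m + β + m).choose m := by
    rw [jacobiAux, Polynomial.finsetSum_coeff, Finset.sum_eq_single m]
    · rw [Polynomial.coeff_C_mul_X_pow, if_pos rfl, Nat.choose_self, Nat.cast_one, mul_one]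
    · intro b _ hb
      rw [Polynomial.coeff_C_mul_X_pow, if_neg hb.symm]
    · simp
  rw [this]
  have := Nat.choose_pos (Nat.le_add_left m (m + β))
  positivity

theorem natDegree_jacobi (β m : ℕ) : (jacobi 0 β m).natDegree = m := by
  have h : (jacobiAux β m).natDegree = m :=
    le_antisymm (natDegree_jacobiAux_le β m)
      (Polynomial.le_natDegree_of_ne_zero (coeff_jacobiAux_self_ne_zero β m))
  have h1 : (Polynomial.C (1 / 2 : ℝ) * (1 - Polynomial.X)).natDegree = 1 := by
    rw [Polynomial.natDegree_C_mul (by norm_num), ← Polynomial.natDegree_neg]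
    rw [neg_sub, ← Polynomial.C_1, Polynomial.natDegree_X_sub_C]
  rw [jacobi_eq_comp, Polynomial.natDegree_comp, h, h1, mul_one]

theorem coeff_jacobi_self_ne_zero (β m : ℕ) : (jacobi 0 β m).coeff m ≠ 0 := by
  rcases Nat.eq_zero_or_pos m with rfl | hm
  · have h : (jacobi 0 β 0) = 1 := by simp [jacobi, shiftedFactorial]
    simp [h]
  · have h : (jacobi 0 β m).leadingCoeff ≠ 0 := by
      rw [Polynomial.leadingCoeff_ne_zero]
      intro h0
      have := natDegree_jacobi β m
      rw [h0, Polynomial.natDegree_zero] at this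
      omega
    rwa [Polynomial.leadingCoeff, natDegree_jacobi] at h

theorem jacobi_legendre_eq_comp (k : ℕ) :
    jacobi 0 0 k = (jacobiAux 0 k).comp (Polynomial.C (1 / 2 : ℝ) * (1 - Polynomial.X)) := by
  simpa using jacobi_eq_comp 0 k

theorem jacobiAux_zero_eq_shiftedLegendre (k : ℕ) :
    jacobiAux 0 k = (Polynomial.shiftedLegendre k).map (Int.castRingHom ℝ) := by
  rw [jacobiAux, Polynomial.shiftedLegendre, Polynomial.map_sum]
  refine Finset.sum_congr rfl fun i _ => ?_
  rw [Polynomial.map_mul, Polynomial.map_C, Polynomial.map_pow, Polynomial.map_X]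
  congr 2
  have : (k + 0 + i).choose i = (k + i).choose k := by
    rw [add_zero, Nat.choose_symm_add]
  rw [this]
  simp

/-- Under `y = (1 - x)/2` the sign change `x ↦ -x` is `y ↦ 1 - y`, so this is the known symmetry of
the shifted Legendre polynomials. -/
theorem jacobi_legendre_comp_neg (k : ℕ) :
    (jacobi 0 0 k).comp (-Polynomial.X) = (-1) ^ k * jacobi 0 0 k := by
  have h := congrArg (Polynomial.map (Int.castRingHom ℝ))
    (Polynomial.neg_one_pow_mul_shiftedLegendre_comp_one_sub_X_eq k)
  simp only [Polynomial.map_mul, Polynomial.map_pow, Polynomial.map_neg, Polynomial.map_one,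
    Polynomial.map_comp, Polynomial.map_sub, Polynomial.map_X,
    ← jacobiAux_zero_eq_shiftedLegendre] at h
  rw [jacobi_legendre_eq_comp, Polynomial.comp_assoc]
  conv_rhs => rw [← h]
  rw [Polynomial.mul_comp (_ ^ k), Polynomial.comp_assoc, Polynomial.pow_comp,
    Polynomial.neg_comp, Polynomial.one_comp, ← mul_assoc, ← mul_pow]
  simp only [neg_mul_neg, one_mul, one_pow, Polynomial.sub_comp, Polynomial.mul_comp,
    Polynomial.C_comp, Polynomial.one_comp, Polynomial.X_comp]
  congr 1
  have : (1 : Polynomial ℝ) = Polynomial.C (1 / 2 : ℝ) * 2 := by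
    rw [show (2 : Polynomial ℝ) = Polynomial.C 2 from rfl, ← Polynomial.C_mul]
    norm_num
  linear_combination -this

/-! ### Orthogonality of Jacobi polynomials in one variable -/

theorem intervalIntegral_pow_mul_one_sub_pow (a b : ℕ) :
    ∫ y in (0 : ℝ)..1, y ^ a * (1 - y) ^ b =
      (a.factorial : ℝ) * b.factorial / (a + b + 1).factorial := by
  induction b generalizing a with
  | zero =>
    simp only [pow_zero, mul_one, integral_pow, Nat.factorial_succ, add_zero, Nat.factorial_zero]
    push_cast
    have : (a.factorial : ℝ) ≠ 0 := by positivity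
    have : (a : ℝ) + 1 ≠ 0 := by positivity
    simp
    field_simp
  | succ b ih =>
    have h : ∀ y : ℝ, y ^ a * (1 - y) ^ (b + 1) =
        y ^ a * (1 - y) ^ b - y ^ (a + 1) * (1 - y) ^ b := fun y => by ring
    simp_rw [h]
    rw [intervalIntegral.integral_sub
      (Continuous.intervalIntegrable (by fun_prop) _ _)
      (Continuous.intervalIntegrable (by fun_prop) _ _), ih, ih]
    rw [show a + 1 + b + 1 = a + b + 1 + 1 by ring, show a + (b + 1) + 1 = a + b + 1 + 1 by ring,
      Nat.factorial_succ (a + b + 1), Nat.factorial_succ a, Nat.factorial_succ b]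
    have : ((a + b + 1).factorial : ℝ) ≠ 0 := by positivity
    have : (a : ℝ) + b + 1 + 1 ≠ 0 := by positivity
    push_cast
    field_simp
    ring

/-- Up to sign the sum is the `m`-th forward difference of `P` at `0`, which vanishes in degree
below `m`. -/
theorem sum_alternating_choose_mul_eval_eq_zero {P : Polynomial ℝ} {m : ℕ}
    (hP : P.natDegree < m) :
    ∑ i ∈ Finset.range (m + 1), (-1 : ℝ) ^ i * m.choose i * P.eval (i : ℝ) = 0 := by
  have h := congrFun (Polynomial.fwdDiff_iter_eq_zero_of_degree_lt hP) 0
  rw [fwdDiff_iter_eq_sum_shift] at h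
  have h2 : ∑ i ∈ Finset.range (m + 1), (-1 : ℝ) ^ i * m.choose i * P.eval (i : ℝ) =
      (-1) ^ m * ∑ k ∈ Finset.range (m + 1),
        ((-1 : ℤ) ^ (m - k) * m.choose k) • P.eval (0 + k • (1 : ℝ)) := by
    rw [Finset.mul_sum]
    refine Finset.sum_congr rfl fun i hi => ?_
    have him : i ≤ m := Nat.lt_succ_iff.1 (Finset.mem_range.1 hi)
    obtain ⟨j, rfl⟩ := Nat.exists_eq_add_of_le him
    have : ((-1 : ℝ) ^ j) * (-1) ^ j = 1 := by rw [← mul_pow]; simp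
    simp only [Nat.add_sub_cancel_left, zsmul_eq_mul, zero_add, nsmul_eq_mul, mul_one]
    push_cast
    rw [pow_add]
    linear_combination
      -((-1 : ℝ) ^ i * (i + j).choose i * P.eval (i : ℝ)) * this
  rw [h2, h]
  simp

theorem ascPochhammer_eval_succ_natCast (a l : ℕ) :
    (a.factorial : ℝ) * (ascPochhammer ℝ l).eval ((a : ℝ) + 1) = (a + l).factorial := by
  have h := ascPochhammer_eval_cast (S := ℝ) l (a + 1)
  rw [ascPochhammer_nat_eq_ascFactorial] at h
  push_cast at h
  rw [← h]
  exact_mod_cast Nat.factorial_mul_ascFactorial a l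

/-- Integrating term by term with the Beta integral leaves an alternating binomial sum of values at
`i` of a polynomial of degree at most `m - 1`. -/
theorem intervalIntegral_jacobiAux_mul_pow (β : ℕ) {m l : ℕ} (hl : l < m) :
    ∫ y in (0 : ℝ)..1, (1 - y) ^ β * (jacobiAux β m).eval y * y ^ l = 0 := by
  -- The two Pochhammer factors are `(i+l)!/i!`, of degree `l` in `i`, and `(m+β+i)!/(i+l+β+1)!`, of
  -- degree `m-1-l`; the latter is a polynomial because `l < m`.
  let P : Polynomial ℝ := Polynomial.C ((β.factorial : ℝ) / (m + β).factorial) *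
    ((ascPochhammer ℝ l).comp (Polynomial.X + Polynomial.C 1) *
      (ascPochhammer ℝ (m - 1 - l)).comp (Polynomial.X + Polynomial.C ((l : ℝ) + β + 2)))
  have hP : P.natDegree < m := by
    have h1 : P.natDegree ≤ l + (m - 1 - l) := by
      refine (Polynomial.natDegree_C_mul_le _ _).trans (Polynomial.natDegree_mul_le.trans ?_)
      rw [Polynomial.natDegree_comp, Polynomial.natDegree_comp, ascPochhammer_natDegree,
        ascPochhammer_natDegree, Polynomial.natDegree_X_add_C, Polynomial.natDegree_X_add_C]
      omega
    omega
  have h : ∀ y : ℝ, (1 - y) ^ β * (jacobiAux β m).eval y * y ^ l =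
      ∑ i ∈ Finset.range (m + 1), (-1 : ℝ) ^ i * m.choose i * (m + β + i).choose i *
        (y ^ (i + l) * (1 - y) ^ β) := by
    intro y
    rw [jacobiAux, Polynomial.eval_finsetSum, Finset.mul_sum, Finset.sum_mul]
    refine Finset.sum_congr rfl fun i _ => ?_
    simp only [Polynomial.eval_mul, Polynomial.eval_C, Polynomial.eval_pow, Polynomial.eval_X]
    ring
  simp_rw [h]
  rw [intervalIntegral.integral_finsetSum
    (fun i _ => Continuous.intervalIntegrable (by fun_prop) _ _)]
  refine (Finset.sum_congr rfl fun i _ => ?_).trans (sum_alternating_choose_mul_eval_eq_zero hP)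
  rw [intervalIntegral.integral_const_mul, intervalIntegral_pow_mul_one_sub_pow, mul_assoc]
  congr 1
  have e1 := ascPochhammer_eval_succ_natCast i l
  have e2 := ascPochhammer_eval_succ_natCast (i + l + β + 1) (m - 1 - l)
  rw [show i + l + β + 1 + (m - 1 - l) = m + β + i by omega] at e2
  have e3 : ((m + β + i).choose i : ℝ) * i.factorial * (m + β).factorial =
      (m + β + i).factorial := by
    have := Nat.add_choose_mul_factorial_mul_factorial (m + β) i
    rw [← this]
    push_cast
    ring
  simp only [P, Polynomial.eval_mul, Polynomial.eval_C, Polynomial.eval_comp, Polynomial.eval_add,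
    Polynomial.eval_X]
  rw [← e1]
  push_cast at e2
  rw [show (i : ℝ) + l + β + 1 + 1 = i + (l + β + 2) by ring] at e2
  have p1 : ((i + l + β + 1).factorial : ℝ) ≠ 0 := by positivity
  have p2 : ((m + β).factorial : ℝ) ≠ 0 := by positivity
  generalize (ascPochhammer ℝ l).eval ((i : ℝ) + 1) = u at *
  generalize (ascPochhammer ℝ (m - 1 - l)).eval ((i : ℝ) + (l + β + 2)) = v at *
  field_simp
  linear_combination u * e3 - u * e2

/-! ### Invariance and definiteness of the pairing -/

open MeasureTheory in
theorem measurePreserving_add_linear {L : (Fin 2 → ℝ) →ₗ[ℝ] (Fin 2 → ℝ)}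
    (hL : |LinearMap.det L| = 1) (c : Fin 2 → ℝ) :
    MeasurePreserving (fun x => c + L x) volume volume := by
  have h0 : LinearMap.det L ≠ 0 := by
    intro h
    simp [h] at hL
  have h1 : MeasurePreserving L volume volume := by
    refine ⟨(LinearMap.continuous_on_pi L).measurable, ?_⟩
    rw [Real.map_linearMap_volume_pi_eq_smul_volume_pi h0, abs_inv, hL]
    simp
  exact (measurePreserving_add_left volume c).comp h1

/-- The affine involution `(x₁,x₂) ↦ (1 - x₁ - x₂,x₂)` of the plane. -/
noncomputable def reflectM : (Fin 2 → ℝ) ≃ₜ (Fin 2 → ℝ) where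
  toFun x := ![1 - x 0 - x 1, x 1]
  invFun x := ![1 - x 0 - x 1, x 1]
  left_inv x := by ext i; fin_cases i <;> simp; ring
  right_inv x := by ext i; fin_cases i <;> simp; ring
  continuous_toFun := by fun_prop
  continuous_invFun := by fun_prop

/-- The coordinate exchange of the plane. -/
noncomputable def reflectR : (Fin 2 → ℝ) ≃ₜ (Fin 2 → ℝ) where
  toFun x := ![x 1, x 0]
  invFun x := ![x 1, x 0]
  left_inv x := by ext i; fin_cases i <;> simp
  right_inv x := by ext i; fin_cases i <;> simp
  continuous_toFun := by fun_prop
  continuous_invFun := by fun_prop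

open MeasureTheory in
theorem measurePreserving_reflectM : MeasurePreserving reflectM volume volume := by
  have h := measurePreserving_add_linear (L := Matrix.toLin' !![-1, -1; 0, 1])
    (by rw [LinearMap.det_toLin', Matrix.det_fin_two]; simp) ![1, 0]
  convert h using 1
  ext x i
  fin_cases i
  · simp [reflectM, dotProduct, Fin.sum_univ_two]; ring
  · simp [reflectM, dotProduct, Fin.sum_univ_two]

open MeasureTheory in
theorem measurePreserving_reflectR : MeasurePreserving reflectR volume volume := by
  have h := measurePreserving_add_linear (L := Matrix.toLin' !![0, 1; 1, 0])
    (by rw [LinearMap.det_toLin', Matrix.det_fin_two]; simp) 0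
  convert h using 1
  ext x i
  fin_cases i <;> simp [reflectR, dotProduct, Fin.sum_univ_two]

theorem preimage_reflectM_refTriangle : reflectM ⁻¹' refTriangle = refTriangle := by
  ext x
  change (0 ≤ 1 - x 0 - x 1 ∧ 0 ≤ x 1 ∧ 1 - x 0 - x 1 + x 1 ≤ 1) ↔
    (0 ≤ x 0 ∧ 0 ≤ x 1 ∧ x 0 + x 1 ≤ 1)
  constructor <;> rintro ⟨h1, h2, h3⟩ <;> refine ⟨?_, ?_, ?_⟩ <;> linarith

theorem preimage_reflectR_refTriangle : reflectR ⁻¹' refTriangle = refTriangle := by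
  ext x
  change (0 ≤ x 1 ∧ 0 ≤ x 0 ∧ x 1 + x 0 ≤ 1) ↔ (0 ≤ x 0 ∧ 0 ≤ x 1 ∧ x 0 + x 1 ≤ 1)
  constructor <;> rintro ⟨h1, h2, h3⟩ <;> refine ⟨?_, ?_, ?_⟩ <;> linarith

theorem eval_aeval (x : Fin 2 → ℝ) (g : Fin 2 → Poly2) (p : Poly2) :
    MvPolynomial.eval x (MvPolynomial.aeval g p) =
      MvPolynomial.eval (fun i => MvPolynomial.eval x (g i)) p := by
  rw [← MvPolynomial.coe_aeval_eq_eval, ← MvPolynomial.coe_aeval_eq_eval]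
  simp only [RingHom.coe_coe]
  rw [← AlgHom.comp_apply, MvPolynomial.comp_aeval]

theorem eval_opM (x : Fin 2 → ℝ) (p : Poly2) :
    MvPolynomial.eval x (opM p) = MvPolynomial.eval (reflectM x) p := by
  refine (eval_aeval x _ p).trans ?_
  congr 2
  ext i
  fin_cases i <;> simp [reflectM]

theorem eval_opR (x : Fin 2 → ℝ) (p : Poly2) :
    MvPolynomial.eval x (opR p) = MvPolynomial.eval (reflectR x) p := by
  refine (eval_aeval x _ p).trans ?_
  congr 2
  ext i
  fin_cases i <;> simp [reflectR]

theorem triangleInner_opM (u v : Poly2) : triangleInner (opM u) (opM v) = triangleInner u v := by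
  have h := measurePreserving_reflectM.setIntegral_preimage_emb
    reflectM.measurableEmbedding
    (fun x => MvPolynomial.eval x u * MvPolynomial.eval x v) refTriangle
  rw [preimage_reflectM_refTriangle] at h
  simp only [triangleInner, eval_opM]
  exact h

theorem triangleInner_opR (u v : Poly2) : triangleInner (opR u) (opR v) = triangleInner u v := by
  have h := measurePreserving_reflectR.setIntegral_preimage_emb
    reflectR.measurableEmbedding
    (fun x => MvPolynomial.eval x u * MvPolynomial.eval x v) refTriangle
  rw [preimage_reflectR_refTriangle] at h
  simp only [triangleInner, eval_opR]
  exact h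

theorem opM_opM (p : Poly2) : opM (opM p) = p := LinearMap.congr_fun opR_opM_relations.2.1 p

theorem opR_opR (p : Poly2) : opR (opR p) = p := LinearMap.congr_fun opR_opM_relations.1 p

/-- The square vanishes almost everywhere on the triangle, hence by continuity everywhere on the
open square `(0,1/2)²` inside it; a polynomial vanishing on a product of infinite sets is zero. -/
theorem triangleInner_self_eq_zero {u : Poly2} (h : triangleInner u u = 0) : u = 0 := by
  have hc : Continuous fun x : Fin 2 → ℝ => MvPolynomial.eval x u :=
    MvPolynomial.continuous_eval u
  have hi := integrableOn_eval (u * u)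
  simp only [map_mul] at hi
  have h1 := (MeasureTheory.setIntegral_eq_zero_iff_of_nonneg_ae
    (Filter.Eventually.of_forall fun x => mul_self_nonneg _) hi).1 h
  have hU : Set.pi Set.univ (fun _ : Fin 2 => Set.Ioo (0 : ℝ) (1 / 2)) ⊆ refTriangle := by
    intro x hx
    have h0 := hx 0 (Set.mem_univ _)
    have h1 := hx 1 (Set.mem_univ _)
    exact ⟨h0.1.le, h1.1.le, by linarith [h0.2, h1.2]⟩
  have h2 := MeasureTheory.Measure.eqOn_open_of_ae_eq
    (MeasureTheory.ae_restrict_of_ae_restrict_of_subset hU h1)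
    (isOpen_set_pi Set.finite_univ fun _ _ => isOpen_Ioo)
    (hc.mul hc).continuousOn continuousOn_const
  refine MvPolynomial.funext_set (fun _ : Fin 2 => Set.Ioo (0 : ℝ) (1 / 2))
    (fun _ => Set.Ioo_infinite (by norm_num)) fun x hx => ?_
  simpa using h2 hx

/-! ### Orthogonality of the basis polynomials on the triangle -/

-- The coordinates `x₁ = s y`, `x₂ = s (1 - y)` have Jacobian `s` in absolute value. They are
-- reached in two steps: a unimodular shear to `(s, x₁)`, then a rescaling of the inner variable.
open MeasureTheory in
theorem integral_refTriangle_eq {f : (Fin 2 → ℝ) → ℝ} (hf : Continuous f) :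
    ∫ x in refTriangle, f x =
      ∫ s in (0 : ℝ)..1, s * ∫ y in (0 : ℝ)..1, f ![s * y, s * (1 - y)] := by
  let S : (Fin 2 → ℝ) ≃ₜ (Fin 2 → ℝ) :=
    { toFun := fun z => ![z 1, z 0 - z 1]
      invFun := fun x => ![x 0 + x 1, x 0]
      left_inv := fun z => by ext i; fin_cases i <;> simp
      right_inv := fun x => by ext i; fin_cases i <;> simp
      continuous_toFun := by fun_prop
      continuous_invFun := by fun_prop }
  have hS : MeasurePreserving S volume volume := by
    have h := measurePreserving_add_linear (L := Matrix.toLin' !![0, 1; 1, -1])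
      (by rw [LinearMap.det_toLin', Matrix.det_fin_two]; simp) 0
    convert h using 1
    ext x i
    fin_cases i
    · simp [S, dotProduct, Fin.sum_univ_two]
    · simp [S, dotProduct, Fin.sum_univ_two]; ring
  have hT := (volume_preserving_finTwoArrow ℝ).symm
  rw [← hS.setIntegral_preimage_emb S.measurableEmbedding,
    ← hT.setIntegral_preimage_emb (MeasurableEquiv.measurableEmbedding _)]
  let D : Set (ℝ × ℝ) := {p | 0 ≤ p.2 ∧ p.2 ≤ p.1 ∧ p.1 ≤ 1}
  have hD : (MeasurableEquiv.finTwoArrow (α := ℝ)).symm ⁻¹' (S ⁻¹' refTriangle) = D := by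
    ext p
    change (0 ≤ p.2 ∧ 0 ≤ p.1 - p.2 ∧ p.2 + (p.1 - p.2) ≤ 1) ↔ (0 ≤ p.2 ∧ p.2 ≤ p.1 ∧ p.1 ≤ 1)
    constructor <;> rintro ⟨h1, h2, h3⟩ <;> refine ⟨?_, ?_, ?_⟩ <;> linarith
  have hDc : IsCompact D := by
    apply (isCompact_Icc (a := (0 : ℝ × ℝ)) (b := 1)).of_isClosed_subset
    · exact (isClosed_le continuous_const continuous_snd).inter
        ((isClosed_le continuous_snd continuous_fst).inter
          (isClosed_le continuous_fst continuous_const))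
    · rintro p ⟨h1, h2, h3⟩
      exact ⟨⟨h1.trans h2, h1⟩, ⟨h3, h2.trans h3⟩⟩
  have hg : ∀ p : ℝ × ℝ, f (S ((MeasurableEquiv.finTwoArrow (α := ℝ)).symm p)) =
      f ![p.2, p.1 - p.2] := fun p => rfl
  have hgc : Continuous fun p : ℝ × ℝ => f ![p.2, p.1 - p.2] := hf.comp (by fun_prop)
  simp_rw [hg]
  rw [hD, ← integral_indicator hDc.measurableSet, Measure.volume_eq_prod, integral_prod]
  swap
  · rw [← Measure.volume_eq_prod, integrable_indicator_iff hDc.measurableSet]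
    exact hgc.continuousOn.integrableOn_compact hDc
  have hin : ∀ s : ℝ, ∫ y, D.indicator (fun p : ℝ × ℝ => f ![p.2, p.1 - p.2]) (s, y) =
      (Set.Icc (0 : ℝ) 1).indicator
        (fun s => s * ∫ y in (0 : ℝ)..1, f ![s * y, s * (1 - y)]) s := by
    intro s
    by_cases hs : s ∈ Set.Icc (0 : ℝ) 1
    · rw [Set.indicator_of_mem hs]
      have e1 : ∀ y, D.indicator (fun p : ℝ × ℝ => f ![p.2, p.1 - p.2]) (s, y) =
          (Set.Icc 0 s).indicator (fun y => f ![y, s - y]) y := by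
        intro y
        by_cases hy : y ∈ Set.Icc 0 s
        · rw [Set.indicator_of_mem hy, Set.indicator_of_mem]
          exact ⟨hy.1, hy.2, hs.2⟩
        · rw [Set.indicator_of_notMem hy, Set.indicator_of_notMem]
          exact fun h => hy ⟨h.1, h.2.1⟩
      simp_rw [e1]
      rw [integral_indicator measurableSet_Icc, integral_Icc_eq_integral_Ioc,
        ← intervalIntegral.integral_of_le hs.1]
      -- In this form the rescaling involves no division, so `s = 0` needs no separate case.
      have e2 := intervalIntegral.mul_integral_comp_mul_left (a := 0) (b := 1)
        (f := fun y => f ![y, s - y]) s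
      rw [mul_zero, mul_one] at e2
      rw [← e2]
      simp_rw [mul_sub, mul_one]
    · rw [Set.indicator_of_notMem hs]
      have e1 : ∀ y, D.indicator (fun p : ℝ × ℝ => f ![p.2, p.1 - p.2]) (s, y) = 0 := by
        intro y
        apply Set.indicator_of_notMem
        exact fun h => hs ⟨h.1.trans h.2.1, h.2.2⟩
      simp [e1]
  simp_rw [hin]
  rw [integral_indicator measurableSet_Icc, integral_Icc_eq_integral_Ioc,
    ← intervalIntegral.integral_of_le zero_le_one]

theorem opM_apply (p : Poly2) : opM p = MvPolynomial.aeval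
    (![1 - MvPolynomial.X 0 - MvPolynomial.X 1, MvPolynomial.X 1] : Fin 2 → Poly2) p := rfl

theorem opR_apply (p : Poly2) : opR p = MvPolynomial.aeval
    (![MvPolynomial.X 1, MvPolynomial.X 0] : Fin 2 → Poly2) p := rfl

theorem algHom_bPoly {A : Type*} [CommRing A] [Algebra ℝ A] (φ : Poly2 →ₐ[ℝ] A) (n k : ℕ) :
    φ (bPoly n k) =
      Polynomial.aeval (2 * (φ (MvPolynomial.X 0) + φ (MvPolynomial.X 1)) - 1)
          (jacobi 0 (2 * (k : ℝ) + 1) (n - k)) *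
        ∑ i ∈ Finset.range (k + 1), algebraMap ℝ A ((jacobi 0 0 k).coeff i) *
          (φ (MvPolynomial.X 0) - φ (MvPolynomial.X 1)) ^ i *
          (φ (MvPolynomial.X 0) + φ (MvPolynomial.X 1)) ^ (k - i) := by
  rw [bPoly, map_mul, ← Polynomial.aeval_algHom_apply, map_sum]
  congr 2
  · rw [map_sub, map_mul, map_add, map_one, map_ofNat]
  · ext i
    rw [map_mul, map_mul, map_pow, map_pow, map_sub, map_add, ← MvPolynomial.algebraMap_eq,
      AlgHom.commutes]

theorem coeff_comp_neg_X (p : Polynomial ℝ) (i : ℕ) :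
    (p.comp (-Polynomial.X)).coeff i = (-1) ^ i * p.coeff i := by
  have h : (-Polynomial.X : Polynomial ℝ) = Polynomial.C (-1) * Polynomial.X := by simp
  rw [h, Polynomial.comp_C_mul_X_coeff, mul_comm]

/-- `R` fixes `x₁ + x₂` and negates `x₁ - x₂`, which an even Legendre polynomial does not notice. -/
theorem opR_bPoly_even (n k : ℕ) : opR (bPoly n (2 * k)) = bPoly n (2 * k) := by
  rw [opR_apply, algHom_bPoly, bPoly]
  simp only [MvPolynomial.aeval_X, Matrix.cons_val_zero, Matrix.cons_val_one,
    MvPolynomial.algebraMap_eq]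
  rw [add_comm (MvPolynomial.X 1 : Poly2)]
  refine congrArg _ (Finset.sum_congr rfl fun i _ => ?_)
  have h := congrArg (fun p => Polynomial.coeff p i) (jacobi_legendre_comp_neg (2 * k))
  simp only [pow_mul, neg_one_sq, one_pow, one_mul, coeff_comp_neg_X] at h
  rw [← neg_sub (MvPolynomial.X 0 : Poly2), neg_pow]
  have h' : (-1 : Poly2) ^ i = MvPolynomial.C ((-1 : ℝ) ^ i) := by simp
  conv_rhs => rw [← h, map_mul, ← h']
  ring

/-- Here `x₁ + x₂ = s` and `(x₁ - x₂)/(x₁ + x₂) = 2y - 1`, so the variables separate; the identity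
also holds at `s = 0`. -/
theorem eval_bPoly_scaled {n k : ℕ} (s y : ℝ) :
    MvPolynomial.eval ![s * y, s * (1 - y)] (bPoly n k) =
      s ^ k * (jacobiAux (2 * k + 1) (n - k)).eval (1 - s) * (jacobiAux 0 k).eval (1 - y) := by
  have h := algHom_bPoly (MvPolynomial.aeval ![s * y, s * (1 - y)] : Poly2 →ₐ[ℝ] ℝ) n k
  rw [← MvPolynomial.coe_aeval_eq_eval]
  refine h.trans ?_
  have hβ : (2 * (k : ℝ) + 1) = ((2 * k + 1 : ℕ) : ℝ) := by push_cast; ring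
  simp only [MvPolynomial.aeval_X, Matrix.cons_val_zero, Matrix.cons_val_one, hβ]
  have e1 : s * y + s * (1 - y) = s := by ring
  have e2 : s * y - s * (1 - y) = s * (2 * y - 1) := by ring
  rw [e1, e2, jacobi_eq_comp, Polynomial.coe_aeval_eq_eval, Polynomial.eval_comp]
  have e3 : ((Polynomial.C (1 / 2 : ℝ) * (1 - Polynomial.X)).eval (2 * s - 1)) = 1 - s := by
    simp
    ring
  rw [e3, mul_comm (s ^ k), mul_assoc]
  congr 1
  have e4 : (jacobiAux 0 k).eval (1 - y) = (jacobi 0 0 k).eval (2 * y - 1) := by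
    rw [jacobi_legendre_eq_comp, Polynomial.eval_comp]
    congr 1
    simp
    ring
  rw [e4, Polynomial.eval_eq_sum_range' (Nat.lt_succ_of_le (natDegree_jacobi_le 0 0 k)),
    Finset.mul_sum]
  refine Finset.sum_congr rfl fun i hi => ?_
  obtain ⟨j, rfl⟩ := Nat.exists_eq_add_of_le (Nat.lt_succ_iff.1 (Finset.mem_range.1 hi))
  rw [Nat.add_sub_cancel_left, pow_add, mul_pow]
  simp only [Algebra.algebraMap_self, RingHom.id_apply]
  ring

theorem intervalIntegral_jacobiAux_mul_eval (β : ℕ) {m : ℕ} {r : Polynomial ℝ}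
    (hr : r.natDegree < m) :
    ∫ y in (0 : ℝ)..1, (1 - y) ^ β * (jacobiAux β m).eval y * r.eval y = 0 := by
  have h : ∀ y : ℝ, (1 - y) ^ β * (jacobiAux β m).eval y * r.eval y =
      ∑ i ∈ Finset.range m,
        r.coeff i * ((1 - y) ^ β * (jacobiAux β m).eval y * y ^ i) := by
    intro y
    rw [Polynomial.eval_eq_sum_range' hr, Finset.mul_sum]
    exact Finset.sum_congr rfl fun i _ => by ring
  simp_rw [h]
  rw [intervalIntegral.integral_finsetSum
    (fun i _ => Continuous.intervalIntegrable (by fun_prop) _ _)]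
  refine Finset.sum_eq_zero fun i hi => ?_
  rw [intervalIntegral.integral_const_mul,
    intervalIntegral_jacobiAux_mul_pow β (Finset.mem_range.1 hi), mul_zero]

theorem intervalIntegral_jacobiAux_one_sub_mul_eval (β : ℕ) {m : ℕ} {r : Polynomial ℝ}
    (hr : r.natDegree < m) :
    ∫ y in (0 : ℝ)..1, y ^ β * (jacobiAux β m).eval (1 - y) * r.eval y = 0 := by
  have h1 : (r.comp (1 - Polynomial.X)).natDegree < m := by
    refine lt_of_le_of_lt (Polynomial.natDegree_comp_le.trans ?_) hr
    have : (1 - Polynomial.X : Polynomial ℝ).natDegree ≤ 1 :=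
      (Polynomial.natDegree_sub_le _ _).trans (by simp)
    nlinarith
  have h2 := intervalIntegral.integral_comp_sub_left (a := 0) (b := 1)
    (fun y : ℝ => (1 - y) ^ β * (jacobiAux β m).eval y * (r.comp (1 - Polynomial.X)).eval y) 1
  rw [sub_self, sub_zero, intervalIntegral_jacobiAux_mul_eval β h1] at h2
  simpa using h2

theorem integral_eval_bPoly_mul_pow_mul_pow {n k a c : ℕ} (hk : k ≤ n) (hac : a + c < n) :
    ∫ x in refTriangle, MvPolynomial.eval x (bPoly n k) * (x 0 ^ a * x 1 ^ c) = 0 := by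
  rw [integral_refTriangle_eq (f := fun x => MvPolynomial.eval x (bPoly n k) * (x 0 ^ a * x 1 ^ c))
    ((MvPolynomial.continuous_eval _).mul (by fun_prop))]
  simp only [eval_bPoly_scaled, Matrix.cons_val_zero, Matrix.cons_val_one]
  -- A monomial of degree below `k` is killed by the Legendre factor in `y`. Otherwise, with `l = a
  -- + c - k < n - k`, the powers of `s` combine to the weight `s^(2k+1)` times `s^l`, and the
  -- Jacobi factor in `s` kills it.
  rcases lt_or_ge (a + c) k with h | h
  · have h0 : ∀ s : ℝ, ∫ y in (0 : ℝ)..1, s ^ k * (jacobiAux (2 * k + 1) (n - k)).eval (1 - s) *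
        (jacobiAux 0 k).eval (1 - y) * ((s * y) ^ a * (s * (1 - y)) ^ c) = 0 := by
      intro s
      have hr : (Polynomial.X ^ a * (1 - Polynomial.X) ^ c : Polynomial ℝ).natDegree < k := by
        refine lt_of_le_of_lt ?_ h
        refine Polynomial.natDegree_mul_le_of_le (Polynomial.natDegree_X_pow_le a) ?_
        have : (1 - Polynomial.X : Polynomial ℝ).natDegree ≤ 1 :=
          (Polynomial.natDegree_sub_le _ _).trans (by simp)
        simpa using Polynomial.natDegree_pow_le_of_le c this
      have h1 := intervalIntegral_jacobiAux_one_sub_mul_eval 0 hr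
      refine Eq.trans ?_ ((congrArg
        (s ^ k * (jacobiAux (2 * k + 1) (n - k)).eval (1 - s) * s ^ (a + c) * ·) h1).trans
          (mul_zero _))
      rw [← intervalIntegral.integral_const_mul]
      refine intervalIntegral.integral_congr fun y _ => ?_
      simp [mul_pow, pow_add]
      ring
    simp [h0]
  · obtain ⟨l, hl⟩ := Nat.exists_eq_add_of_le h
    have hr : (Polynomial.X ^ l : Polynomial ℝ).natDegree < n - k := by
      rw [Polynomial.natDegree_X_pow]
      omega
    have h1 := intervalIntegral_jacobiAux_one_sub_mul_eval (2 * k + 1) hr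
    refine Eq.trans ?_ ((congrArg
      (· * ∫ y in (0 : ℝ)..1, (jacobiAux 0 k).eval (1 - y) * (y ^ a * (1 - y) ^ c)) h1).trans
        (zero_mul _))
    rw [← intervalIntegral.integral_mul_const]
    refine intervalIntegral.integral_congr fun s _ => ?_
    simp only [Polynomial.eval_pow, Polynomial.eval_X]
    rw [← intervalIntegral.integral_const_mul, ← intervalIntegral.integral_const_mul]
    refine intervalIntegral.integral_congr fun y _ => ?_
    have e : s ^ a * s ^ c = s ^ k * s ^ l := by rw [← pow_add, hl, pow_add]
    simp only [mul_pow]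
    linear_combination (s * s ^ k * (jacobiAux (2 * k + 1) (n - k)).eval (1 - s) *
      (jacobiAux 0 k).eval (1 - y) * y ^ a * (1 - y) ^ c) * e

theorem triangleInner_bPoly_eq_zero {n k : ℕ} (hk : k ≤ n) {v : Poly2}
    (hv : v.totalDegree < n) : triangleInner (bPoly n k) v = 0 := by
  have h : ∀ x : Fin 2 → ℝ, MvPolynomial.eval x (bPoly n k) * MvPolynomial.eval x v =
      ∑ d ∈ v.support, v.coeff d *
        (MvPolynomial.eval x (bPoly n k) * (x 0 ^ d 0 * x 1 ^ d 1)) := by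
    intro x
    conv_lhs => rw [v.as_sum, map_sum, Finset.mul_sum]
    refine Finset.sum_congr rfl fun d _ => ?_
    rw [MvPolynomial.eval_monomial, Finsupp.prod_fintype _ _ (fun i => pow_zero _),
      Fin.prod_univ_two]
    ring
  simp only [triangleInner, h]
  rw [MeasureTheory.integral_finsetSum]
  · refine Finset.sum_eq_zero fun d hd => ?_
    rw [MeasureTheory.integral_const_mul, integral_eval_bPoly_mul_pow_mul_pow hk, mul_zero]
    have := (MvPolynomial.le_totalDegree hd).trans_lt hv
    rwa [Finsupp.sum_fintype _ _ (fun _ => rfl), Fin.sum_univ_two] at this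
  · intro d _
    refine ContinuousOn.integrableOn_compact isCompact_refTriangle (Continuous.continuousOn ?_)
    exact continuous_const.mul ((MvPolynomial.continuous_eval _).mul (by fun_prop))

/-! ### Degree bounds and stability of the orthogonal space -/

theorem totalDegree_aeval_le_of_totalDegree_le_one {g : Fin 2 → Poly2}
    (hg : ∀ i, (g i).totalDegree ≤ 1) (p : Poly2) :
    (MvPolynomial.aeval g p).totalDegree ≤ p.totalDegree := by
  conv_lhs => rw [p.as_sum, map_sum]
  refine MvPolynomial.totalDegree_finsetSum_le fun d hd => ?_
  have h := MvPolynomial.le_totalDegree hd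
  rw [Finsupp.sum_fintype _ _ (fun _ => rfl), Fin.sum_univ_two] at h
  rw [MvPolynomial.aeval_monomial, Finsupp.prod_fintype _ _ (fun i => pow_zero _),
    Fin.prod_univ_two, MvPolynomial.algebraMap_eq]
  have h0 := (MvPolynomial.totalDegree_pow (g 0) (d 0)).trans (Nat.mul_le_mul_left _ (hg 0))
  have h1 := (MvPolynomial.totalDegree_pow (g 1) (d 1)).trans (Nat.mul_le_mul_left _ (hg 1))
  refine (MvPolynomial.totalDegree_mul _ _).trans ?_
  rw [MvPolynomial.totalDegree_C, zero_add]
  exact (MvPolynomial.totalDegree_mul _ _).trans (by omega)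

theorem totalDegree_opM_le (p : Poly2) : (opM p).totalDegree ≤ p.totalDegree := by
  refine totalDegree_aeval_le_of_totalDegree_le_one (fun i => ?_) p
  fin_cases i
  · refine (MvPolynomial.totalDegree_sub _ _).trans (max_le ?_ (by simp))
    exact (MvPolynomial.totalDegree_sub _ _).trans (by simp)
  · simp

theorem totalDegree_opR_le (p : Poly2) : (opR p).totalDegree ≤ p.totalDegree := by
  refine totalDegree_aeval_le_of_totalDegree_le_one (fun i => ?_) p
  fin_cases i <;> simp

theorem totalDegree_bPoly_le {n k : ℕ} (hk : k ≤ n) : (bPoly n k).totalDegree ≤ n := by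
  have hs : (MvPolynomial.X 0 + MvPolynomial.X 1 : Poly2).totalDegree ≤ 1 :=
    (MvPolynomial.totalDegree_add _ _).trans (by simp)
  have hd : (MvPolynomial.X 0 - MvPolynomial.X 1 : Poly2).totalDegree ≤ 1 :=
    (MvPolynomial.totalDegree_sub _ _).trans (by simp)
  have ht : (2 * (MvPolynomial.X 0 + MvPolynomial.X 1) - 1 : Poly2).totalDegree ≤ 1 := by
    refine (MvPolynomial.totalDegree_sub _ _).trans (max_le ?_ (by simp))
    refine (MvPolynomial.totalDegree_mul _ _).trans ?_
    have : (2 : Poly2).totalDegree = 0 := MvPolynomial.totalDegree_C (2 : ℝ)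
    omega
  have h1 : (Polynomial.aeval (2 * (MvPolynomial.X 0 + MvPolynomial.X 1) - 1 : Poly2)
      (jacobi 0 (2 * (k : ℝ) + 1) (n - k))).totalDegree ≤ n - k := by
    rw [Polynomial.aeval_eq_sum_range]
    refine MvPolynomial.totalDegree_finsetSum_le fun i hi => ?_
    refine (MvPolynomial.totalDegree_smul_le _ _).trans
      ((MvPolynomial.totalDegree_pow _ _).trans ?_)
    have := natDegree_jacobi_le 0 (2 * (k : ℝ) + 1) (n - k)
    have := Finset.mem_range.1 hi
    exact (Nat.mul_le_mul_left _ ht).trans (by omega)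
  refine (MvPolynomial.totalDegree_mul _ _).trans ((add_le_add h1 (?_ : _ ≤ k)).trans (by omega))
  refine MvPolynomial.totalDegree_finsetSum_le fun i hi => ?_
  have := Finset.mem_range.1 hi
  have e1 := (MvPolynomial.totalDegree_pow _ i).trans (Nat.mul_le_mul_left _ hd)
  have e2 := (MvPolynomial.totalDegree_pow _ (k - i)).trans (Nat.mul_le_mul_left _ hs)
  refine (MvPolynomial.totalDegree_mul _ _).trans ((add_le_add
    ((MvPolynomial.totalDegree_mul _ _).trans (add_le_add (MvPolynomial.totalDegree_C _).le e1))
    e2).trans (by omega))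

theorem bPoly_mem_orthPoly {n k : ℕ} (hk : k ≤ n) : bPoly n k ∈ orthPoly n :=
  ⟨totalDegree_bPoly_le hk, fun _ hn hv => triangleInner_bPoly_eq_zero hk (by omega)⟩

theorem opM_mem_orthPoly {n : ℕ} {u : Poly2} (hu : u ∈ orthPoly n) : opM u ∈ orthPoly n := by
  refine ⟨(totalDegree_opM_le u).trans hu.1, fun v hn hv => ?_⟩
  rw [← opM_opM v, triangleInner_opM]
  exact hu.2 _ hn ((totalDegree_opM_le v).trans hv)

theorem opR_mem_orthPoly {n : ℕ} {u : Poly2} (hu : u ∈ orthPoly n) : opR u ∈ orthPoly n := by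
  refine ⟨(totalDegree_opR_le u).trans hu.1, fun v hn hv => ?_⟩
  rw [← opR_opR v, triangleInner_opR]
  exact hu.2 _ hn ((totalDegree_opR_le v).trans hv)

/-! ### Leading forms -/

/-- Without a leading form, `u` has degree below `n` and is orthogonal to itself. For `n = 0` there
is no orthogonality to use, but no monomials remain either. -/
theorem eq_zero_of_mem_orthPoly {n : ℕ} {u : Poly2} (hu : u ∈ orthPoly n)
    (h : MvPolynomial.homogeneousComponent n u = 0) : u = 0 := by
  have hc : ∀ d ∈ u.support, d 0 + d 1 < n := by
    intro d hd
    have h1 := (MvPolynomial.le_totalDegree hd).trans hu.1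
    rw [Finsupp.sum_fintype _ _ (fun _ => rfl), Fin.sum_univ_two] at h1
    refine lt_of_le_of_ne h1 fun h2 => MvPolynomial.mem_support_iff.1 hd ?_
    have h3 := congrArg (MvPolynomial.coeff d) h
    rwa [MvPolynomial.coeff_homogeneousComponent, if_pos, MvPolynomial.coeff_zero] at h3
    rw [Finsupp.degree_eq_sum, Fin.sum_univ_two, h2]
  rcases Nat.eq_zero_or_pos n with rfl | hn
  · rw [← MvPolynomial.support_eq_empty, Finset.eq_empty_iff_forall_notMem]
    exact fun d hd => absurd (hc d hd) (Nat.not_lt_zero _)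
  · refine triangleInner_self_eq_zero (hu.2 u hn ?_)
    rw [MvPolynomial.totalDegree, Finset.sup_le_iff]
    intro d hd
    have := hc d hd
    rw [Finsupp.sum_fintype _ _ (fun _ => rfl), Fin.sum_univ_two]
    omega

open MvPolynomial (homogeneousComponent IsHomogeneous)

theorem coeff_affine_pow_mul_affine_pow {A : Type*} [CommRing A] (c a : Fin 2 → A) (i j : ℕ) :
    ((Polynomial.C (c 0) + Polynomial.C (a 0) * Polynomial.X) ^ i *
        (Polynomial.C (c 1) + Polynomial.C (a 1) * Polynomial.X) ^ j).natDegree ≤ i + j ∧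
      ((Polynomial.C (c 0) + Polynomial.C (a 0) * Polynomial.X) ^ i *
        (Polynomial.C (c 1) + Polynomial.C (a 1) * Polynomial.X) ^ j).coeff (i + j) =
        a 0 ^ i * a 1 ^ j := by
  have hd : ∀ l : Fin 2,
      (Polynomial.C (c l) + Polynomial.C (a l) * Polynomial.X).natDegree ≤ 1 := fun l =>
    Polynomial.natDegree_add_le_of_degree_le (by simp)
      ((Polynomial.natDegree_C_mul_le _ _).trans Polynomial.natDegree_X_le)
  have hp : ∀ (l : Fin 2) (m : ℕ),
      ((Polynomial.C (c l) + Polynomial.C (a l) * Polynomial.X) ^ m).natDegree ≤ m := fun l m => by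
    simpa using Polynomial.natDegree_pow_le_of_le m (hd l)
  have hc : ∀ (l : Fin 2) (m : ℕ),
      ((Polynomial.C (c l) + Polynomial.C (a l) * Polynomial.X) ^ m).coeff m = a l ^ m :=
    fun l m => by
      have := Polynomial.coeff_pow_of_natDegree_le (m := m) (hd l)
      simpa using this
  refine ⟨Polynomial.natDegree_mul_le_of_le (hp 0 i) (hp 1 j), ?_⟩
  rw [Polynomial.coeff_mul_add_eq_of_natDegree_le (hp 0 i) (hp 1 j), hc, hc]

/-- The coefficient of the highest power along affine lines is the value of the top homogeneous
component. -/
theorem coeff_aeval_affine {A : Type*} [CommRing A] [Algebra ℝ A] (c a : Fin 2 → A) {n : ℕ}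
    {u : Poly2} (hu : u.totalDegree ≤ n) :
    (MvPolynomial.aeval
      (fun i => Polynomial.C (c i) + Polynomial.C (a i) * Polynomial.X) u).coeff n =
      MvPolynomial.aeval a (homogeneousComponent n u) := by
  rw [MvPolynomial.homogeneousComponent_apply, map_sum, Finset.sum_filter]
  conv_lhs => rw [u.as_sum, map_sum, Polynomial.finsetSum_coeff]
  refine Finset.sum_congr rfl fun d hd => ?_
  have h := (MvPolynomial.le_totalDegree hd).trans hu
  rw [Finsupp.sum_fintype _ _ (fun _ => rfl), Fin.sum_univ_two] at h
  obtain ⟨h1, h2⟩ := coeff_affine_pow_mul_affine_pow c a (d 0) (d 1)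
  have hdeg : d.degree = d 0 + d 1 := by rw [Finsupp.degree_eq_sum, Fin.sum_univ_two]
  rw [MvPolynomial.aeval_monomial, MvPolynomial.aeval_monomial,
    Finsupp.prod_fintype _ _ (fun i => pow_zero _), Finsupp.prod_fintype _ _ (fun i => pow_zero _),
    Fin.prod_univ_two, Fin.prod_univ_two, Polynomial.algebraMap_apply, Polynomial.coeff_C_mul,
    hdeg]
  split_ifs with hn
  · rw [← hn, h2]
  · rw [Polynomial.coeff_eq_zero_of_natDegree_lt (h1.trans_lt (lt_of_le_of_ne h hn)), mul_zero]

theorem coeff_aeval_X_eq_homogeneousComponent {n : ℕ} {u : Poly2} (hu : u.totalDegree ≤ n) :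
    (MvPolynomial.aeval
      (fun i => Polynomial.C (MvPolynomial.X i : Poly2) * Polynomial.X) u).coeff n =
      homogeneousComponent n u := by
  have h := coeff_aeval_affine (A := Poly2) (fun _ => 0) MvPolynomial.X hu
  simpa using h

/-- The linear part `(x₁,x₂) ↦ (-x₁-x₂,x₂)` of the substitution defining `opM`. -/
noncomputable def linM : Poly2 →ₐ[ℝ] Poly2 :=
  MvPolynomial.aeval ![-MvPolynomial.X 0 - MvPolynomial.X 1, MvPolynomial.X 1]

/-- The leading form is the coefficient of `T^n` after `xᵢ ↦ xᵢ T`. Composed with `opM` this is the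
substitution `(1 + (-x₁ - x₂) T, x₂ T)`, whose constant terms do not affect that coefficient. -/
theorem homogeneousComponent_opM {n : ℕ} {u : Poly2} (hu : u.totalDegree ≤ n) :
    homogeneousComponent n (opM u) = linM (homogeneousComponent n u) := by
  rw [← coeff_aeval_X_eq_homogeneousComponent ((totalDegree_opM_le u).trans hu), linM,
    ← coeff_aeval_affine ![1, 0] _ hu, opM_apply, ← AlgHom.comp_apply, MvPolynomial.comp_aeval]
  congr 3
  ext i : 1
  fin_cases i
  · simp
    ring
  · simp

theorem homogeneousComponent_opR {n : ℕ} {u : Poly2} (hu : u.totalDegree ≤ n) :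
    homogeneousComponent n (opR u) = opR (homogeneousComponent n u) := by
  rw [← coeff_aeval_X_eq_homogeneousComponent ((totalDegree_opR_le u).trans hu),
    opR_apply (homogeneousComponent n u),
    ← coeff_aeval_affine 0 _ hu, opR_apply, ← AlgHom.comp_apply, MvPolynomial.comp_aeval]
  congr 3
  ext i : 1
  fin_cases i <;> simp

/-- The coefficient of `s^(n-k)` in `P_{n-k}^{(0,2k+1)}(2 s - 1)`. -/
noncomputable def topCoeff (n k : ℕ) : ℝ :=
  (jacobi 0 (2 * (k : ℝ) + 1) (n - k)).coeff (n - k) * 2 ^ (n - k)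

theorem topCoeff_ne_zero (n k : ℕ) : topCoeff n k ≠ 0 := by
  have hβ : (2 * (k : ℝ) + 1) = ((2 * k + 1 : ℕ) : ℝ) := by push_cast; ring
  rw [topCoeff, hβ]
  exact mul_ne_zero (coeff_jacobi_self_ne_zero _ _) (by positivity)

theorem coeff_aeval_affine_polynomial {A : Type*} [CommRing A] [Algebra ℝ A] (c a : A) {m : ℕ}
    {p : Polynomial ℝ} (hp : p.natDegree ≤ m) :
    (Polynomial.aeval (Polynomial.C c + Polynomial.C a * Polynomial.X) p).natDegree ≤ m ∧
    (Polynomial.aeval (Polynomial.C c + Polynomial.C a * Polynomial.X) p).coeff m =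
      algebraMap ℝ A (p.coeff m) * a ^ m := by
  have h := fun i => coeff_affine_pow_mul_affine_pow (fun _ => c) (fun _ => a) i 0
  simp only [pow_zero, mul_one, add_zero] at h
  rw [Polynomial.aeval_eq_sum_range' (Nat.lt_succ_of_le hp)]
  constructor
  · refine Polynomial.natDegree_sum_le_of_forall_le _ _ fun i hi => ?_
    exact (Polynomial.natDegree_smul_le _ _).trans
      ((h i).1.trans (Nat.lt_succ_iff.1 (Finset.mem_range.1 hi)))
  · rw [Polynomial.finsetSum_coeff, Finset.sum_range_succ, Finset.sum_eq_zero, zero_add,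
      Polynomial.coeff_smul, (h m).2, Algebra.smul_def]
    intro i hi
    rw [Polynomial.coeff_smul, Polynomial.coeff_eq_zero_of_natDegree_lt
      ((h i).1.trans_lt (Finset.mem_range.1 hi)), smul_zero]

theorem homogeneousComponent_bPoly {n k : ℕ} (hk : k ≤ n) :
    homogeneousComponent n (bPoly n k) =
      MvPolynomial.C (topCoeff n k) * (MvPolynomial.X 0 + MvPolynomial.X 1) ^ (n - k) *
        ∑ i ∈ Finset.range (k + 1),
          MvPolynomial.C ((jacobi 0 0 k).coeff i) *
            (MvPolynomial.X 0 - MvPolynomial.X 1) ^ i *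
            (MvPolynomial.X 0 + MvPolynomial.X 1) ^ (k - i) := by
  rw [← coeff_aeval_X_eq_homogeneousComponent (totalDegree_bPoly_le hk), algHom_bPoly]
  simp only [MvPolynomial.aeval_X]
  set s : Poly2 := MvPolynomial.X 0 + MvPolynomial.X 1 with hs
  set d : Poly2 := MvPolynomial.X 0 - MvPolynomial.X 1 with hd
  have e1 : (Polynomial.C (MvPolynomial.X 0 : Poly2) * Polynomial.X +
      Polynomial.C (MvPolynomial.X 1 : Poly2) * Polynomial.X) =
      Polynomial.C s * Polynomial.X := by rw [hs, map_add]; ring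
  have e2 : (Polynomial.C (MvPolynomial.X 0 : Poly2) * Polynomial.X -
      Polynomial.C (MvPolynomial.X 1 : Poly2) * Polynomial.X) =
      Polynomial.C d * Polynomial.X := by rw [hd, map_sub]; ring
  have e3 : 2 * (Polynomial.C s * Polynomial.X) - 1 =
      Polynomial.C (-1) + Polynomial.C (2 * s) * Polynomial.X := by
    rw [map_neg, map_one, map_mul, map_ofNat]
    ring
  have e4 : ∑ i ∈ Finset.range (k + 1),
      algebraMap ℝ (Polynomial Poly2) ((jacobi 0 0 k).coeff i) *
        (Polynomial.C d * Polynomial.X) ^ i * (Polynomial.C s * Polynomial.X) ^ (k - i) =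
      Polynomial.C (∑ i ∈ Finset.range (k + 1),
        MvPolynomial.C ((jacobi 0 0 k).coeff i) * d ^ i * s ^ (k - i)) * Polynomial.X ^ k := by
    rw [map_sum, Finset.sum_mul]
    refine Finset.sum_congr rfl fun i hi => ?_
    obtain ⟨j, rfl⟩ := Nat.exists_eq_add_of_le (Nat.lt_succ_iff.1 (Finset.mem_range.1 hi))
    rw [Nat.add_sub_cancel_left, Polynomial.algebraMap_apply, MvPolynomial.algebraMap_eq]
    simp only [map_mul, map_pow]
    ring
  rw [e1, e2, e3, e4, ← mul_assoc]
  conv_lhs => rw [show n = (n - k) + k by omega, Polynomial.coeff_mul_X_pow]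
  rw [Polynomial.coeff_mul_C, Nat.sub_add_cancel hk,
    (coeff_aeval_affine_polynomial (-1 : Poly2) (2 * s) (natDegree_jacobi_le _ _ _)).2,
    MvPolynomial.algebraMap_eq, topCoeff, map_mul, mul_pow]
  have e5 : (2 : Poly2) ^ (n - k) = MvPolynomial.C ((2 : ℝ) ^ (n - k)) := by
    rw [map_pow, map_ofNat]
  rw [e5, mul_assoc (MvPolynomial.C _) (MvPolynomial.C _)]

/-! ### Restriction of forms to the line `x₁ + x₂ = 1` -/

/-- Restriction of a polynomial to the line `x₁ + x₂ = 1`, with parameter `x₁ - x₂`. -/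
noncomputable def restrictLine : Poly2 →ₐ[ℝ] Polynomial ℝ :=
  MvPolynomial.aeval ![Polynomial.C (1 / 2) * (1 + Polynomial.X),
    Polynomial.C (1 / 2) * (1 - Polynomial.X)]

theorem restrictLine_X_zero :
    restrictLine (MvPolynomial.X 0) = Polynomial.C (1 / 2) * (1 + Polynomial.X) := by
  simp [restrictLine]

theorem restrictLine_X_one :
    restrictLine (MvPolynomial.X 1) = Polynomial.C (1 / 2) * (1 - Polynomial.X) := by
  simp [restrictLine]

theorem C_half_mul_two : (Polynomial.C (1 / 2 : ℝ)) * 2 = 1 := by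
  rw [show (2 : Polynomial ℝ) = Polynomial.C 2 from rfl, ← Polynomial.C_mul]
  norm_num

theorem restrictLine_add :
    restrictLine (MvPolynomial.X 0 + MvPolynomial.X 1) = 1 := by
  rw [map_add, restrictLine_X_zero, restrictLine_X_one]
  linear_combination C_half_mul_two

theorem restrictLine_sub :
    restrictLine (MvPolynomial.X 0 - MvPolynomial.X 1) = Polynomial.X := by
  rw [map_sub, restrictLine_X_zero, restrictLine_X_one]
  linear_combination Polynomial.X * C_half_mul_two

theorem restrictLine_homogeneousComponent_bPoly {n k : ℕ} (hk : k ≤ n) :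
    restrictLine (homogeneousComponent n (bPoly n k)) =
      Polynomial.C (topCoeff n k) * jacobi 0 0 k := by
  rw [homogeneousComponent_bPoly hk, map_mul, map_mul, map_pow, restrictLine_add, one_pow, mul_one,
    map_sum, ← MvPolynomial.algebraMap_eq, AlgHom.commutes, Polynomial.algebraMap_apply,
    Algebra.algebraMap_self, RingHom.id_apply]
  congr 1
  conv_rhs => rw [Polynomial.as_sum_range' (jacobi 0 0 k) (k + 1)
    (Nat.lt_succ_of_le (natDegree_jacobi_le 0 0 k))]
  refine Finset.sum_congr rfl fun i _ => ?_
  rw [map_mul, map_mul, map_pow, map_pow, restrictLine_add, restrictLine_sub, one_pow, mul_one,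
    AlgHom.commutes, Polynomial.algebraMap_apply, Algebra.algebraMap_self, RingHom.id_apply,
    Polynomial.C_mul_X_pow_eq_monomial]

theorem restrictLine_opR (p : Poly2) :
    restrictLine (opR p) = (restrictLine p).comp (-Polynomial.X) := by
  have h : (restrictLine.comp (MvPolynomial.aeval
      (![MvPolynomial.X 1, MvPolynomial.X 0] : Fin 2 → Poly2))) =
      (Polynomial.aeval (-Polynomial.X : Polynomial ℝ)).comp restrictLine := by
    ext i : 1
    fin_cases i
    · simp [restrictLine, sub_eq_add_neg]
    · simp [restrictLine, sub_eq_add_neg]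
  have := DFunLike.congr_fun h p
  rw [AlgHom.comp_apply, AlgHom.comp_apply] at this
  exact this

theorem eval_smul_of_isHomogeneous {n : ℕ} {g : Poly2} (hg : g.IsHomogeneous n) (s : ℝ)
    (x : Fin 2 → ℝ) :
    MvPolynomial.eval (s • x) g = s ^ n * MvPolynomial.eval x g := by
  rw [MvPolynomial.eval_eq', MvPolynomial.eval_eq', Finset.mul_sum]
  refine Finset.sum_congr rfl fun d hd => ?_
  have h := hg (MvPolynomial.mem_support_iff.1 hd)
  have hdeg : d.degree = Finsupp.weight 1 d := by rw [Finsupp.degree_eq_weight_one]; rfl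
  rw [← hdeg, Finsupp.degree_eq_sum, Fin.sum_univ_two] at h
  simp only [Fin.prod_univ_two, Pi.smul_apply, smul_eq_mul, mul_pow]
  rw [← h, pow_add]
  ring

theorem eq_zero_of_restrictLine_eq_zero {n : ℕ} {g : Poly2} (hg : g.IsHomogeneous n)
    (h : restrictLine g = 0) : g = 0 := by
  have hs : (MvPolynomial.X 0 + MvPolynomial.X 1 : Poly2) ≠ 0 := by
    intro h0
    have := restrictLine_add
    rw [h0, map_zero] at this
    exact zero_ne_one this
  -- Homogeneity rescales to the line only points with `x₁ + x₂ ≠ 0`; the extra factor takes care of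
  -- the others.
  refine (mul_eq_zero.1 (?_ : (MvPolynomial.X 0 + MvPolynomial.X 1) * g = 0)).resolve_left hs
  refine MvPolynomial.funext fun x => ?_
  rw [map_mul, map_add, MvPolynomial.eval_X, MvPolynomial.eval_X, map_zero]
  rcases eq_or_ne (x 0 + x 1) 0 with h0 | h0
  · rw [h0, zero_mul]
  · have hx : x = (x 0 + x 1) • fun i => Polynomial.aeval ((x 0 - x 1) / (x 0 + x 1))
        (restrictLine (MvPolynomial.X i)) := by
      ext i
      fin_cases i
      · simp [restrictLine_X_zero]
        field_simp
        ring
      · simp [restrictLine_X_one]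
        field_simp
        ring
    have he : MvPolynomial.eval x g = 0 := by
      rw [hx, eval_smul_of_isHomogeneous hg]
      have : MvPolynomial.eval (fun i => Polynomial.aeval ((x 0 - x 1) / (x 0 + x 1))
          (restrictLine (MvPolynomial.X i))) g =
          Polynomial.aeval ((x 0 - x 1) / (x 0 + x 1)) (restrictLine g) := by
        rw [← MvPolynomial.coe_aeval_eq_eval, ← AlgHom.comp_apply,
          MvPolynomial.aeval_unique ((Polynomial.aeval ((x 0 - x 1) / (x 0 + x 1))).comp
            restrictLine)]
        rfl
      rw [this, h, map_zero, mul_zero]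
    rw [he, mul_zero]

/-! ### The operator `Π` on `R`-invariant polynomials -/

theorem opM_opR_opM (p : Poly2) : opM (opR (opM p)) = opR (opM (opR p)) := by
  have h := LinearMap.congr_fun opR_opM_relations.2.2 (opR (opM (opR p)))
  have h' : opM (opR (opM (opR (opM (opR (opR (opM (opR p)))))))) = opR (opM (opR p)) := h
  rwa [opR_opR, opM_opM, opR_opR] at h'

theorem opPi_apply (p : Poly2) :
    opPi p = (1 / 3 : ℝ) • ((2 : ℝ) • p - opM (opR p) - opR (opM p)) := rfl

theorem opPi_mem_orthPoly {n : ℕ} {u : Poly2} (hu : u ∈ orthPoly n) : opPi u ∈ orthPoly n :=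
  Submodule.smul_mem _ _ (Submodule.sub_mem _ (Submodule.sub_mem _ (Submodule.smul_mem _ _ hu)
    (opM_mem_orthPoly (opR_mem_orthPoly hu))) (opR_mem_orthPoly (opM_mem_orthPoly hu)))

theorem opR_opPi {u : Poly2} (hu : opR u = u) : opR (opPi u) = opPi u := by
  simp only [opPi_apply, hu, map_smul, map_sub, opR_opR]
  congr 1
  abel

theorem opPi_add_opM_add_opR_opM {u : Poly2} (hu : opR u = u) :
    opPi u + opM (opPi u) + opR (opM (opPi u)) = 0 := by
  have h := opM_opR_opM u
  rw [hu] at h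
  simp only [opPi_apply, hu, map_smul, map_sub, opM_opM, opR_opR, h]
  module

/-- The hypothesis reads `2u - Mu - RMu = 0`. Applying the rotation `MR` gives `2Mu - RMu - u = 0`,
and the difference is `3(Mu - u) = 0`. -/
theorem opM_eq_self_of_opPi_eq_zero {u : Poly2} (hR : opR u = u) (h : opPi u = 0) :
    opM u = u := by
  rw [opPi_apply, hR, smul_eq_zero_iff_right (by norm_num)] at h
  have h2 := congrArg (fun p => opM (opR p)) h
  have h3 := opM_opR_opM u
  rw [hR] at h3
  simp only [map_sub, map_smul, map_zero, hR, h3, opR_opR, opM_opM] at h2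
  have e : (3 : ℝ) • (opM u - u) =
      ((2 : ℝ) • opM u - opR (opM u) - u) - ((2 : ℝ) • u - opM u - opR (opM u)) := by module
  have : (3 : ℝ) • (opM u - u) = 0 := by rw [e, h2, h, sub_zero]
  rwa [smul_eq_zero_iff_right (by norm_num), sub_eq_zero] at this

theorem opPi_eq_zero_of_invariant {u : Poly2} (hR : opR u = u) (hM : opM u = u) :
    opPi u = 0 := by
  rw [opPi_apply, hR, hM, hR]
  module

/-! ### Divisibility of invariant forms and linear independence -/

/-- `linM` carries `x₁ + x₂` to `-x₁`, and `R` carries `x₁` to `x₂`, so invariance moves the divisor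
to `x₁^m` and `x₂^m`. On the line these are, up to units, powers of the coprime polynomials `t + 1`
and `t - 1`. -/
theorem one_add_X_mul_one_sub_X_pow_dvd {g : Poly2} {m : ℕ} (hR : opR g = g) (hM : linM g = g)
    (h : (MvPolynomial.X 0 + MvPolynomial.X 1) ^ m ∣ g) :
    ((Polynomial.X + Polynomial.C 1) ^ m * (Polynomial.X - Polynomial.C 1) ^ m : Polynomial ℝ) ∣
      restrictLine g := by
  have h0 : (MvPolynomial.X 0 : Poly2) ^ m ∣ g := by
    have := map_dvd linM h
    rw [hM, map_pow] at this
    have e : linM (MvPolynomial.X 0 + MvPolynomial.X 1) = -MvPolynomial.X 0 := by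
      simp [linM]
    rw [e] at this
    exact (pow_dvd_pow_of_dvd (dvd_neg.2 dvd_rfl) m).trans this
  have h1 : (MvPolynomial.X 1 : Poly2) ^ m ∣ g := by
    have := map_dvd (MvPolynomial.aeval
      (![MvPolynomial.X 1, MvPolynomial.X 0] : Fin 2 → Poly2)) h0
    rw [← opR_apply g, hR, map_pow] at this
    simpa using this
  have hu : IsUnit (Polynomial.C (1 / 2 : ℝ)) := Polynomial.isUnit_C.2 (by norm_num)
  refine IsCoprime.mul_dvd ?_ ?_ ?_
  · refine IsCoprime.pow ?_
    have := Polynomial.isCoprime_X_sub_C_of_isUnit_sub (a := (-1 : ℝ)) (b := 1) (by norm_num)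
    simpa using this
  · have := map_dvd restrictLine h0
    rw [map_pow, restrictLine_X_zero] at this
    refine (pow_dvd_pow_of_dvd ?_ m).trans this
    rw [hu.dvd_mul_left, add_comm, map_one]
  · have := map_dvd restrictLine h1
    rw [map_pow, restrictLine_X_one] at this
    refine (pow_dvd_pow_of_dvd ?_ m).trans this
    rw [hu.dvd_mul_left, map_one, ← dvd_neg, neg_sub]

/-- A symmetric homogeneous polynomial of degree `n` cannot be divisible by a high power of
`x₁ + x₂` and have low degree on the line `x₁ + x₂ = 1`. -/
theorem restrictLine_eq_zero_of_invariant {g : Poly2} {m : ℕ} (hR : opR g = g) (hM : linM g = g)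
    (h : (MvPolynomial.X 0 + MvPolynomial.X 1) ^ m ∣ g)
    (hdeg : (restrictLine g).natDegree < 2 * m) : restrictLine g = 0 := by
  refine Polynomial.eq_zero_of_dvd_of_natDegree_lt (one_add_X_mul_one_sub_X_pow_dvd hR hM h) ?_
  have hmon : ∀ a : ℝ, ((Polynomial.X + Polynomial.C a) ^ m).Monic := fun a =>
    (Polynomial.monic_X_add_C a).pow m
  have hmon' : ((Polynomial.X - Polynomial.C (1 : ℝ)) ^ m).Monic :=
    (Polynomial.monic_X_sub_C 1).pow m
  rw [(hmon 1).natDegree_mul hmon', Polynomial.natDegree_pow, Polynomial.natDegree_pow,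
    Polynomial.natDegree_X_add_C, Polynomial.natDegree_X_sub_C]
  omega

/-- The Legendre polynomials as a sequence with one polynomial in each degree. -/
noncomputable def legendreSequence : Polynomial.Sequence ℝ where
  elems' k := jacobi 0 0 k
  degree_eq' k := by
    have h : (jacobi 0 0 k).natDegree = k := by simpa using natDegree_jacobi 0 k
    rw [Polynomial.degree_eq_natDegree, h]
    intro h0
    refine coeff_jacobi_self_ne_zero 0 k ?_
    rw [Nat.cast_zero, h0, Polynomial.coeff_zero]

theorem linearIndependent_jacobi_legendre :
    LinearIndependent ℝ (fun k : ℕ => jacobi 0 0 k) :=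
  legendreSequence.linearIndependent

theorem linearIndependent_opPi_bPoly (n : ℕ) :
    LinearIndependent ℝ (fun k : {k : ℕ // 3 * k + 1 ≤ n} => opPi (bPoly n (2 * k))) := by
  rw [linearIndependent_iff']
  intro s c hc k₀ hk₀
  have hn : 1 ≤ n := by have := k₀.2; omega
  have hk : ∀ k : {k : ℕ // 3 * k + 1 ≤ n}, 2 * (k : ℕ) ≤ n := fun k => by have := k.2; omega
  let f : Poly2 := ∑ k ∈ s, c k • bPoly n (2 * k)
  have hfV : f ∈ orthPoly n := Submodule.sum_mem _ fun k _ =>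
    Submodule.smul_mem _ _ (bPoly_mem_orthPoly (hk k))
  have hfR : opR f = f := by simp only [f, map_sum, map_smul, opR_bPoly_even]
  have hfP : opPi f = 0 := by simpa only [f, map_sum, map_smul] using hc
  have hfM : opM f = f := opM_eq_self_of_opPi_eq_zero hfR hfP
  have hg : restrictLine (homogeneousComponent n f) =
      ∑ k ∈ s, (c k * topCoeff n (2 * k)) • jacobi 0 0 (2 * k) := by
    simp only [f, map_sum, map_smul, restrictLine_homogeneousComponent_bPoly (hk _)]
    refine Finset.sum_congr rfl fun k _ => ?_
    rw [← Polynomial.smul_eq_C_mul, smul_smul]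
  have h0 : restrictLine (homogeneousComponent n f) = 0 := by
    -- With `K = (n-1)/3` rounded down, `m = n - 2K` is the least exponent of `x₁ + x₂` guaranteed
    -- among the leading forms, and the degree is at most `2K`. The required `2K < 2m` is `3K < n`:
    -- this is where the range of `k` enters.
    refine restrictLine_eq_zero_of_invariant (m := n - 2 * ((n - 1) / 3)) ?_ ?_ ?_ ?_
    · rw [← homogeneousComponent_opR hfV.1, hfR]
    · rw [← homogeneousComponent_opM hfV.1, hfM]
    · simp only [f, map_sum, map_smul, homogeneousComponent_bPoly (hk _)]
      refine Finset.dvd_sum fun k _ => ?_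
      rw [MvPolynomial.smul_eq_C_mul]
      refine Dvd.dvd.mul_left ?_ _
      refine Dvd.dvd.mul_right (Dvd.dvd.mul_left (pow_dvd_pow _ ?_) _) _
      have := k.2
      omega
    · rw [hg]
      refine lt_of_le_of_lt (Polynomial.natDegree_sum_le_of_forall_le s _ fun k _ =>
        (Polynomial.natDegree_smul_le _ _).trans ((natDegree_jacobi_le 0 0 _).trans
          (?_ : 2 * (k : ℕ) ≤ 2 * ((n - 1) / 3)))) (by omega)
      have := k.2
      omega
  rw [hg] at h0
  have hli : LinearIndependent ℝ
      (fun k : {k : ℕ // 3 * k + 1 ≤ n} => jacobi 0 0 (2 * (k : ℕ))) :=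
    linearIndependent_jacobi_legendre.comp (fun k : {k : ℕ // 3 * k + 1 ≤ n} => 2 * (k : ℕ))
      fun a b hab => Subtype.ext (by simpa using hab)
  exact (mul_eq_zero.1 (linearIndependent_iff'.1 hli s _ h0 k₀ hk₀)).resolve_right
    (topCoeff_ne_zero n _)

/-! ### Invariant forms and spanning by `Π b_{n,2k}` -/

/-- Triangular elimination: subtracting a multiple of `F J` removes the coefficient of degree `2J`,
and the odd coefficients vanish by parity. -/
theorem mem_span_of_even {F : ℕ → Polynomial ℝ} {n : ℕ}
    (hdeg : ∀ j, 2 * j ≤ n → (F j).natDegree = 2 * j)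
    (hne : ∀ j, 2 * j ≤ n → F j ≠ 0)
    (heven : ∀ j, 2 * j ≤ n → (F j).comp (-Polynomial.X) = F j)
    {S : Submodule ℝ (Polynomial ℝ)} (hS : ∀ j, 2 * j ≤ n → F j ∈ S)
    {G : Polynomial ℝ} (hG : G.natDegree ≤ n) (hGeven : G.comp (-Polynomial.X) = G) : G ∈ S := by
  have hodd : ∀ p : Polynomial ℝ, p.comp (-Polynomial.X) = p → ∀ i, p.coeff (2 * i + 1) = 0 := by
    intro p hp i
    have h := coeff_comp_neg_X p (2 * i + 1)
    rw [hp, pow_succ, pow_mul, neg_one_sq, one_pow, one_mul, neg_one_mul] at h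
    linarith
  have key : ∀ J : ℕ, 2 * J ≤ n + 2 → ∀ G : Polynomial ℝ, G.comp (-Polynomial.X) = G →
      (∀ i, 2 * J ≤ i → G.coeff i = 0) → G ∈ S := by
    intro J
    induction J with
    | zero =>
      intro _ G _ hG
      have : G = 0 := Polynomial.ext fun i => by simpa using hG i (Nat.zero_le i)
      rw [this]
      exact S.zero_mem
    | succ J ih =>
      intro hJ G hGe hG
      have hJ' : 2 * J ≤ n := by omega
      have hl : (F J).coeff (2 * J) ≠ 0 := by
        rw [← hdeg J hJ']
        exact Polynomial.leadingCoeff_ne_zero.2 (hne J hJ')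
      have h1 : G - (G.coeff (2 * J) / (F J).coeff (2 * J)) • F J ∈ S := by
        refine ih (by omega) _ ?_ fun i hi => ?_
        · rw [Polynomial.sub_comp, Polynomial.smul_comp, hGe, heven J hJ']
        · rw [Polynomial.coeff_sub, Polynomial.coeff_smul, smul_eq_mul]
          rcases hi.eq_or_lt with rfl | hi
          · rw [div_mul_cancel₀ _ hl, sub_self]
          · have hFi : (F J).coeff i = 0 :=
              Polynomial.coeff_eq_zero_of_natDegree_lt (by rwa [hdeg J hJ'])
            rw [hFi, mul_zero, sub_zero]
            rcases (Nat.succ_le_of_lt hi).eq_or_lt with rfl | hi'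
            · exact hodd G hGe J
            · exact hG i (by omega)
      have h2 := S.add_mem h1 (S.smul_mem (G.coeff (2 * J) / (F J).coeff (2 * J)) (hS J hJ'))
      rwa [sub_add_cancel] at h2
  refine key (n / 2 + 1) (by omega) G hGeven fun i hi => ?_
  exact Polynomial.coeff_eq_zero_of_natDegree_lt (by omega)

/-- The quadratic invariant of the linear action of `S₃`. -/
noncomputable def quadInvariant : Poly2 :=
  MvPolynomial.X 0 * MvPolynomial.X 1 - (MvPolynomial.X 0 + MvPolynomial.X 1) ^ 2

/-- The cubic invariant of the linear action of `S₃`. -/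
noncomputable def cubicInvariant : Poly2 :=
  MvPolynomial.X 0 * MvPolynomial.X 1 * (MvPolynomial.X 0 + MvPolynomial.X 1)

theorem linM_quadInvariant : linM quadInvariant = quadInvariant := by
  simp [linM, quadInvariant]
  ring

theorem linM_cubicInvariant : linM cubicInvariant = cubicInvariant := by
  simp [linM, cubicInvariant]
  ring

theorem opR_quadInvariant : opR quadInvariant = quadInvariant := by
  simp [opR_apply, quadInvariant]
  ring

theorem opR_cubicInvariant : opR cubicInvariant = cubicInvariant := by
  simp [opR_apply, cubicInvariant]
  ring

theorem isHomogeneous_quadInvariant : quadInvariant.IsHomogeneous 2 :=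
  ((MvPolynomial.isHomogeneous_X ℝ 0).mul (MvPolynomial.isHomogeneous_X ℝ 1)).sub
    (((MvPolynomial.isHomogeneous_X ℝ 0).add (MvPolynomial.isHomogeneous_X ℝ 1)).pow 2)

theorem isHomogeneous_cubicInvariant : cubicInvariant.IsHomogeneous 3 :=
  ((MvPolynomial.isHomogeneous_X ℝ 0).mul (MvPolynomial.isHomogeneous_X ℝ 1)).mul
    ((MvPolynomial.isHomogeneous_X ℝ 0).add (MvPolynomial.isHomogeneous_X ℝ 1))

theorem natDegree_restrictLine_quadInvariant : (restrictLine quadInvariant).natDegree = 2 := by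
  rw [quadInvariant, map_sub, map_mul, map_pow, restrictLine_add, restrictLine_X_zero,
    restrictLine_X_one]
  have : Polynomial.C (1 / 2 : ℝ) * (1 + Polynomial.X) *
      (Polynomial.C (1 / 2) * (1 - Polynomial.X)) - 1 ^ 2 =
      Polynomial.C (-1 / 4) * Polynomial.X ^ 2 + Polynomial.C 0 * Polynomial.X +
        Polynomial.C (-3 / 4) := by
    refine Polynomial.funext fun t => ?_
    simp
    ring
  rw [this, Polynomial.natDegree_quadratic (by norm_num)]

theorem natDegree_restrictLine_cubicInvariant : (restrictLine cubicInvariant).natDegree = 2 := by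
  rw [cubicInvariant, map_mul, map_mul, restrictLine_add, restrictLine_X_zero,
    restrictLine_X_one]
  have : Polynomial.C (1 / 2 : ℝ) * (1 + Polynomial.X) *
      (Polynomial.C (1 / 2) * (1 - Polynomial.X)) * 1 =
      Polynomial.C (-1 / 4) * Polynomial.X ^ 2 + Polynomial.C 0 * Polynomial.X +
        Polynomial.C (1 / 4) := by
    refine Polynomial.funext fun t => ?_
    simp
    ring
  rw [this, Polynomial.natDegree_quadratic (by norm_num)]

/-- The homogeneous polynomials of degree `n` that are invariant under the linear action
of `S₃`. -/
noncomputable def linInvariants (n : ℕ) : Submodule ℝ Poly2 :=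
  MvPolynomial.homogeneousSubmodule (Fin 2) ℝ n ⊓
    (LinearMap.ker (linM.toLinearMap - LinearMap.id) ⊓ LinearMap.ker (opR - LinearMap.id))

theorem mem_linInvariants {n : ℕ} {g : Poly2} :
    g ∈ linInvariants n ↔ g.IsHomogeneous n ∧ linM g = g ∧ opR g = g := by
  simp [linInvariants, sub_eq_zero]

/-- The exponents solve `2p + 3q = n` and `p + q = j`. Both generators restrict to degree 2 on the
line, so the product restricts to degree `2j`. -/
theorem quadInvariant_pow_mul_cubicInvariant_pow_mem {n j : ℕ} (h1 : n ≤ 3 * j) (h2 : 2 * j ≤ n) :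
    quadInvariant ^ (3 * j - n) * cubicInvariant ^ (n - 2 * j) ∈ linInvariants n := by
  rw [mem_linInvariants]
  refine ⟨?_, ?_, ?_⟩
  · have h := (isHomogeneous_quadInvariant.pow (3 * j - n)).mul
      (isHomogeneous_cubicInvariant.pow (n - 2 * j))
    rwa [show 2 * (3 * j - n) + 3 * (n - 2 * j) = n by omega] at h
  · rw [map_mul, map_pow, map_pow, linM_quadInvariant, linM_cubicInvariant]
  · have h3 := opR_quadInvariant
    have h4 := opR_cubicInvariant
    rw [opR_apply] at h3 h4 ⊢
    rw [map_mul, map_pow, map_pow, h3, h4]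

theorem exists_bPoly_combination_add_invariant {n : ℕ} {w : Poly2} (hw : w ∈ orthPoly n)
    (hR : opR w = w) :
    ∃ b ∈ Submodule.span ℝ
        (Set.range fun k : {k : ℕ // 3 * k + 1 ≤ n} => bPoly n (2 * k)),
      ∃ g ∈ linInvariants n, homogeneousComponent n w = homogeneousComponent n b + g := by
  let W := Submodule.span ℝ (Set.range fun k : {k : ℕ // 3 * k + 1 ≤ n} => bPoly n (2 * k))
  -- One `R`-invariant form for each even degree `2j ≤ n` on the line: leading forms of basis
  -- polynomials below the threshold `3j = n`, invariants from there on.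
  let F : ℕ → Poly2 := fun j => if 3 * j + 1 ≤ n then homogeneousComponent n (bPoly n (2 * j))
    else quadInvariant ^ (3 * j - n) * cubicInvariant ^ (n - 2 * j)
  let S : Submodule ℝ (Polynomial ℝ) :=
    (W.map (homogeneousComponent n) ⊔ linInvariants n).map restrictLine.toLinearMap
  have hdeg : ∀ j, 2 * j ≤ n → (restrictLine (F j)).natDegree = 2 * j ∧ restrictLine (F j) ≠ 0 := by
    intro j hj
    by_cases h : 3 * j + 1 ≤ n
    · simp only [F, if_pos h, restrictLine_homogeneousComponent_bPoly hj]
      constructor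
      · rw [Polynomial.natDegree_C_mul (topCoeff_ne_zero _ _)]
        simpa using natDegree_jacobi 0 (2 * j)
      · exact mul_ne_zero (Polynomial.C_ne_zero.2 (topCoeff_ne_zero _ _))
          (legendreSequence.ne_zero (2 * j))
    · simp only [F, if_neg h, map_mul, map_pow]
      have hq : restrictLine quadInvariant ≠ 0 := by
        intro h0
        have := natDegree_restrictLine_quadInvariant
        simp [h0] at this
      have hc : restrictLine cubicInvariant ≠ 0 := by
        intro h0
        have := natDegree_restrictLine_cubicInvariant
        simp [h0] at this
      refine ⟨?_, mul_ne_zero (pow_ne_zero _ hq) (pow_ne_zero _ hc)⟩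
      rw [Polynomial.natDegree_mul (pow_ne_zero _ hq) (pow_ne_zero _ hc), Polynomial.natDegree_pow,
        Polynomial.natDegree_pow, natDegree_restrictLine_quadInvariant,
        natDegree_restrictLine_cubicInvariant]
      omega
  have hFR : ∀ j, 2 * j ≤ n → opR (F j) = F j := by
    intro j hj
    by_cases h : 3 * j + 1 ≤ n
    · simp only [F, if_pos h]
      rw [← homogeneousComponent_opR (totalDegree_bPoly_le hj), opR_bPoly_even]
    · simp only [F, if_neg h]
      exact (mem_linInvariants.1
        (quadInvariant_pow_mul_cubicInvariant_pow_mem (by omega) hj)).2.2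
  have hFS : ∀ j, 2 * j ≤ n → restrictLine (F j) ∈ S := by
    intro j hj
    refine Submodule.mem_map_of_mem (f := restrictLine.toLinearMap) ?_
    by_cases h : 3 * j + 1 ≤ n
    · simp only [F, if_pos h]
      exact Submodule.mem_sup_left (Submodule.mem_map_of_mem
        (Submodule.subset_span ⟨⟨j, h⟩, rfl⟩))
    · simp only [F, if_neg h]
      exact Submodule.mem_sup_right
        (quadInvariant_pow_mul_cubicInvariant_pow_mem (by omega) hj)
  have hG : (restrictLine (homogeneousComponent n w)).natDegree ≤ n := by
    have h : ∀ i : Fin 2, (restrictLine (MvPolynomial.X i)).natDegree ≤ 1 := by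
      intro i
      fin_cases i
      · simp only [Fin.zero_eta, restrictLine_X_zero]
        exact (Polynomial.natDegree_C_mul_le _ _).trans
          ((Polynomial.natDegree_add_le _ _).trans (by simp))
      · simp only [Fin.mk_one, restrictLine_X_one]
        exact (Polynomial.natDegree_C_mul_le _ _).trans
          ((Polynomial.natDegree_sub_le _ _).trans (by simp))
    rw [MvPolynomial.homogeneousComponent_apply, map_sum]
    refine Polynomial.natDegree_sum_le_of_forall_le _ _ fun d hd => ?_
    have hd' := (Finset.mem_filter.1 hd).2
    rw [Finsupp.degree_eq_sum, Fin.sum_univ_two] at hd'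
    rw [MvPolynomial.monomial_eq, map_mul, ← MvPolynomial.algebraMap_eq, AlgHom.commutes,
      Finsupp.prod_fintype _ _ (fun i => pow_zero _), Fin.prod_univ_two, map_mul, map_pow, map_pow]
    refine (Polynomial.natDegree_C_mul_le _ _).trans ?_
    refine (Polynomial.natDegree_mul_le_of_le (Polynomial.natDegree_pow_le_of_le _ (h 0))
      (Polynomial.natDegree_pow_le_of_le _ (h 1))).trans ?_
    omega
  have hGe : (restrictLine (homogeneousComponent n w)).comp (-Polynomial.X) =
      restrictLine (homogeneousComponent n w) := by
    rw [← restrictLine_opR, ← homogeneousComponent_opR hw.1, hR]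
  obtain ⟨y, hy, hyw⟩ := mem_span_of_even (F := fun j => restrictLine (F j))
    (fun j hj => (hdeg j hj).1) (fun j hj => (hdeg j hj).2)
    (fun j hj => by rw [← restrictLine_opR, hFR j hj]) hFS hG hGe
  obtain ⟨_, ⟨b, hb, rfl⟩, g, hg, rfl⟩ := Submodule.mem_sup.1 hy
  refine ⟨b, hb, g, hg, ?_⟩
  have hhom : (homogeneousComponent n w - (homogeneousComponent n b + g)).IsHomogeneous n :=
    (MvPolynomial.homogeneousComponent_isHomogeneous n w).sub
      ((MvPolynomial.homogeneousComponent_isHomogeneous n b).add (mem_linInvariants.1 hg).1)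
  refine sub_eq_zero.1 (eq_zero_of_restrictLine_eq_zero hhom ?_)
  rw [map_sub, sub_eq_zero]
  exact hyw.symm

theorem mem_span_opPi_bPoly {n : ℕ} {w : Poly2} (hw : w ∈ orthPoly n) (hR : opR w = w)
    (hP : opPi w = w) :
    w ∈ Submodule.span ℝ
      (Set.range fun k : {k : ℕ // 3 * k + 1 ≤ n} => opPi (bPoly n (2 * k))) := by
  obtain ⟨b, hb, g, hg, hwg⟩ := exists_bPoly_combination_add_invariant hw hR
  have hbV : b ∈ orthPoly n := by
    refine Submodule.span_le.2 ?_ hb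
    rintro _ ⟨k, rfl⟩
    exact bPoly_mem_orthPoly (by have := k.2; omega)
  have hbR : opR b = b := by
    have : Submodule.span ℝ (Set.range fun k : {k : ℕ // 3 * k + 1 ≤ n} => bPoly n (2 * k)) ≤
        LinearMap.ker (opR - LinearMap.id) := by
      refine Submodule.span_le.2 ?_
      rintro _ ⟨k, rfl⟩
      simp [opR_bPoly_even]
    simpa [sub_eq_zero] using this hb
  have huV : w - b ∈ orthPoly n := Submodule.sub_mem _ hw hbV
  -- The leading form of `w - b` is `g`, which `linM` fixes; injectivity of leading forms on the
  -- orthogonal space lifts this to `opM`.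
  have hM : opM (w - b) = w - b := by
    refine sub_eq_zero.1 (eq_zero_of_mem_orthPoly
      (Submodule.sub_mem _ (opM_mem_orthPoly huV) huV) ?_)
    have h : homogeneousComponent n (w - b) = g := by
      rw [map_sub, hwg, add_sub_cancel_left]
    rw [map_sub, homogeneousComponent_opM huV.1, h, (mem_linInvariants.1 hg).2.1, sub_self]
  have h := opPi_eq_zero_of_invariant (by rw [map_sub, hR, hbR]) hM
  rw [map_sub, hP, sub_eq_zero] at h
  rw [h]
  have := Submodule.mem_map_of_mem (f := opPi) hb
  rwa [Submodule.map_span, ← Set.range_comp] at this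

/-! ### Copies of the reflection representation and their generators -/

theorem sigma1_mulVec (v : Fin 2 → ℝ) : sigma1.mulVec v = ![-v 0, v 1] := by
  ext i
  fin_cases i <;> simp [sigma1, Matrix.mulVec, dotProduct, Fin.sum_univ_two]

theorem sigma2_mulVec (v : Fin 2 → ℝ) :
    sigma2.mulVec v = ![1 / 2 * v 0 + v 1, 3 / 4 * v 0 - 1 / 2 * v 1] := by
  ext i
  fin_cases i
  · simp [sigma2, Matrix.mulVec, dotProduct, Fin.sum_univ_two]
  · simp [sigma2, Matrix.mulVec, dotProduct, Fin.sum_univ_two]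
    ring

/-- The module generated by an `R`-invariant polynomial `h`, parametrized by `ℝ²`. -/
noncomputable def reflMap (h : Poly2) : (Fin 2 → ℝ) →ₗ[ℝ] Poly2 :=
  (LinearMap.proj 0).smulRight (opM h + (1 / 2 : ℝ) • h) + (LinearMap.proj 1).smulRight h

theorem reflMap_apply (h : Poly2) (v : Fin 2 → ℝ) :
    reflMap h v = v 0 • (opM h + (1 / 2 : ℝ) • h) + v 1 • h := rfl

theorem opM_reflMap (h : Poly2) (v : Fin 2 → ℝ) :
    opM (reflMap h v) = reflMap h (sigma2.mulVec v) := by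
  simp only [reflMap_apply, sigma2_mulVec, map_add, map_smul, opM_opM, Matrix.cons_val_zero,
    Matrix.cons_val_one]
  module

theorem opR_reflMap {h : Poly2} (hR : opR h = h) (h0 : h + opM h + opR (opM h) = 0)
    (v : Fin 2 → ℝ) : opR (reflMap h v) = reflMap h (sigma1.mulVec v) := by
  have h1 : opR (opM h) = -h - opM h := by rw [← sub_eq_zero, ← h0]; abel
  simp only [reflMap_apply, sigma1_mulVec, map_add, map_smul, hR, h1, Matrix.cons_val_zero,
    Matrix.cons_val_one]
  module

theorem reflMap_injective {h : Poly2} (hne : h ≠ 0) (hR : opR h = h)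
    (h0 : h + opM h + opR (opM h) = 0) : Function.Injective (reflMap h) := by
  rw [injective_iff_map_eq_zero]
  intro v hv
  -- Adding the `R`-image of `reflMap h v` leaves `2 v₁ h`. Applying the same conclusion to `σ₂ v`
  -- then forces `v₀ = 0` too.
  have key : ∀ v, reflMap h v = 0 → v 1 = 0 := by
    intro v hv
    have h2 := opR_reflMap hR h0 v
    rw [hv, map_zero, sigma1_mulVec] at h2
    have h3 : (2 * v 1) • h = reflMap h v + reflMap h ![-v 0, v 1] := by
      simp only [reflMap_apply, Matrix.cons_val_zero, Matrix.cons_val_one]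
      module
    rw [hv, ← h2, add_zero] at h3
    have := (smul_eq_zero.1 h3).resolve_right hne
    linarith
  have e1 := key v hv
  have e2 := key (sigma2.mulVec v) (by rw [← opM_reflMap, hv, map_zero])
  rw [sigma2_mulVec] at e2
  simp only [Matrix.cons_val_one, Matrix.cons_val_fin_one, e1] at e2
  ext i
  fin_cases i
  · simp only [Fin.zero_eta, Pi.zero_apply]
    linarith
  · simpa using e1

theorem realizesRefl_range_reflMap {h : Poly2} (hne : h ≠ 0) (hR : opR h = h)
    (h0 : h + opM h + opR (opM h) = 0) : RealizesRefl (LinearMap.range (reflMap h)) :=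
  ⟨LinearEquiv.ofInjective (reflMap h) (reflMap_injective hne hR h0),
    fun v => ⟨opR_reflMap hR h0 v, opM_reflMap h v⟩⟩

theorem opR_opM_mem_range_reflMap {h : Poly2} (h0 : h + opM h + opR (opM h) = 0) :
    opR (opM h) ∈ LinearMap.range (reflMap h) := by
  have h1 : opR (opM h) = -h - opM h := by rw [← sub_eq_zero, ← h0]; abel
  refine ⟨![-1, -1 / 2], ?_⟩
  rw [h1, reflMap_apply]
  simp only [Matrix.cons_val_zero, Matrix.cons_val_one]
  module

theorem opM_mem_range_reflMap (h : Poly2) : opM h ∈ LinearMap.range (reflMap h) := by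
  refine ⟨![1, -1 / 2], ?_⟩
  rw [reflMap_apply]
  simp only [Matrix.cons_val_zero, Matrix.cons_val_one]
  module

/-- The generator is the image `w` of `(0,1)`, which `σ₁` fixes. Since `σ₂ (0,1) = (1,-1/2)`, the
image of `(1,0)` is `Mw + w/2`, which explains the shape of `reflMap`. -/
theorem RealizesRefl.exists_generator {E : Submodule ℝ Poly2} (hE : RealizesRefl E) :
    ∃ w ∈ E, opR w = w ∧ w + opM w + opR (opM w) = 0 ∧ E ≤ LinearMap.range (reflMap w) := by
  obtain ⟨e, he⟩ := hE
  have hadd : ∀ a b : ℝ, (e ![a, b] : Poly2) =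
      a • (e ![1, 0] : Poly2) + b • (e ![0, 1] : Poly2) := by
    intro a b
    have : (![a, b] : Fin 2 → ℝ) = a • ![1, 0] + b • ![0, 1] := by
      ext i
      fin_cases i <;> simp
    rw [this, map_add, map_smul, map_smul]
    rfl
  have hRw : opR (e ![0, 1] : Poly2) = e ![0, 1] := by
    rw [(he _).1, sigma1_mulVec]
    simp
  have hRf : opR (e ![1, 0] : Poly2) = -(e ![1, 0] : Poly2) := by
    rw [(he _).1, sigma1_mulVec, hadd]
    simp
  have hMw : opM (e ![0, 1] : Poly2) = e ![1, 0] - (1 / 2 : ℝ) • (e ![0, 1] : Poly2) := by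
    rw [(he _).2, sigma2_mulVec, hadd]
    simp
    module
  refine ⟨e ![0, 1], (e ![0, 1]).2, hRw, ?_, ?_⟩
  · rw [hMw, map_sub, map_smul, hRw, hRf]
    module
  · intro x hx
    obtain ⟨v, hv⟩ := e.surjective ⟨x, hx⟩
    refine ⟨v, ?_⟩
    have h1 : x = (e v : Poly2) := by rw [hv]
    have h2 : v = ![v 0, v 1] := by
      ext i
      fin_cases i <;> rfl
    rw [h1, reflMap_apply, hMw]
    conv_rhs => rw [h2, hadd]
    module

theorem opPi_eq_self {w : Poly2} (hR : opR w = w) (h0 : w + opM w + opR (opM w) = 0) :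
    opPi w = w := by
  have h1 : opR (opM w) = -w - opM w := by rw [← sub_eq_zero, ← h0]; abel
  rw [opPi_apply, hR, h1]
  module

theorem span_opPi_bPoly_properties {n : ℕ} {A : Poly2}
    (hA : A ∈ Submodule.span ℝ
      (Set.range fun k : {k : ℕ // 3 * k + 1 ≤ n} => opPi (bPoly n (2 * k)))) :
    opR A = A ∧ A + opM A + opR (opM A) = 0 := by
  induction hA using Submodule.span_induction with
  | mem x hx =>
    obtain ⟨k, rfl⟩ := hx
    exact ⟨opR_opPi (opR_bPoly_even _ _), opPi_add_opM_add_opR_opM (opR_bPoly_even _ _)⟩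
  | zero => simp
  | add x y _ _ hx hy =>
    refine ⟨by rw [map_add, hx.1, hy.1], ?_⟩
    have := congrArg₂ (· + ·) hx.2 hy.2
    simp only [add_zero] at this
    rw [← this]
    simp only [map_add]
    abel
  | smul a x _ hx =>
    refine ⟨by rw [map_smul, hx.1], ?_⟩
    rw [map_smul, map_smul, ← smul_add, ← smul_add, hx.2, smul_zero]

/-! ### The two rotated families form a basis of the reflection component -/

theorem range_opR_opM_comp (n : ℕ) :
    Submodule.span ℝ (Set.range fun k : {k : ℕ // 3 * k + 1 ≤ n} =>
      opR (opM (opPi (bPoly n (2 * k))))) =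
    (Submodule.span ℝ (Set.range fun k : {k : ℕ // 3 * k + 1 ≤ n} =>
      opPi (bPoly n (2 * k)))).map (opR ∘ₗ opM) := by
  rw [Submodule.map_span, ← Set.range_comp]
  rfl

theorem range_opM_opR_comp (n : ℕ) :
    Submodule.span ℝ (Set.range fun k : {k : ℕ // 3 * k + 1 ≤ n} =>
      opM (opR (opPi (bPoly n (2 * k))))) =
    (Submodule.span ℝ (Set.range fun k : {k : ℕ // 3 * k + 1 ≤ n} =>
      opPi (bPoly n (2 * k)))).map (opM ∘ₗ opR) := by
  rw [Submodule.map_span, ← Set.range_comp]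
  rfl

theorem opM_injective : Function.Injective opM :=
  Function.LeftInverse.injective opM_opM

theorem opR_injective : Function.Injective opR :=
  Function.LeftInverse.injective opR_opR

theorem linearIndependent_rotations_opPi_bPoly (n : ℕ) :
    LinearIndependent ℝ (Sum.elim
      (fun k : {k : ℕ // 3 * k + 1 ≤ n} => opR (opM (opPi (bPoly n (2 * k)))))
      (fun k : {k : ℕ // 3 * k + 1 ≤ n} => opM (opR (opPi (bPoly n (2 * k)))))) := by
  have hli := linearIndependent_opPi_bPoly n
  refine LinearIndependent.sum_type
    (hli.map' (opR ∘ₗ opM) (LinearMap.ker_eq_bot.2 (opR_injective.comp opM_injective)))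
    (hli.map' (opM ∘ₗ opR) (LinearMap.ker_eq_bot.2 (opM_injective.comp opR_injective))) ?_
  rw [Submodule.disjoint_def]
  intro x hx hx'
  have hx1 := (range_opR_opM_comp n).le hx
  have hx2 := (range_opM_opR_comp n).le hx'
  obtain ⟨A, hA, hAx⟩ := hx1
  obtain ⟨C, hC, hCx⟩ := hx2
  obtain ⟨-, hA2⟩ := span_opPi_bPoly_properties hA
  obtain ⟨hC1, hC2⟩ := span_opPi_bPoly_properties hC
  -- An element common to both spans is `RMA = MRC = MC`. Thus `A + MA + MC = 0`, and applying `M`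
  -- gives `MA + A + C = 0`. Hence `MC = C`, and the relation for `C` becomes `3C = 0`.
  have e1 : opR (opM A) = opM C := by
    have : opR (opM A) = opM (opR C) := hAx.trans hCx.symm
    rwa [hC1] at this
  rw [e1] at hA2
  have e2 := congrArg opM hA2
  rw [map_add, map_add, opM_opM, opM_opM, map_zero] at e2
  have e3 : opM C = C := by
    rw [← sub_eq_zero]
    calc opM C - C = (A + opM A + opM C) - (opM A + A + C) := by abel
      _ = 0 := by rw [hA2, e2, sub_zero]
  rw [e3, hC1] at hC2
  have e4 : C = 0 := by
    have : (3 : ℝ) • C = 0 := by rw [← hC2]; module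
    rwa [smul_eq_zero_iff_right (by norm_num)] at this
  rw [← hCx, e4, map_zero]

theorem range_reflMap_le_orthPoly {n : ℕ} {h : Poly2} (hV : h ∈ orthPoly n) :
    LinearMap.range (reflMap h) ≤ orthPoly n := by
  rintro _ ⟨v, rfl⟩
  rw [reflMap_apply]
  exact Submodule.add_mem _ (Submodule.smul_mem _ _
    (Submodule.add_mem _ (opM_mem_orthPoly hV) (Submodule.smul_mem _ _ hV)))
    (Submodule.smul_mem _ _ hV)

theorem range_reflMap_opPi_bPoly_le (n : ℕ) (k : {k : ℕ // 3 * k + 1 ≤ n}) :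
    LinearMap.range (reflMap (opPi (bPoly n (2 * k)))) ≤ reflComponent n :=
  le_sSup ⟨range_reflMap_le_orthPoly
      (opPi_mem_orthPoly (bPoly_mem_orthPoly (by have := k.2; omega))),
    realizesRefl_range_reflMap ((linearIndependent_opPi_bPoly n).ne_zero k)
      (opR_opPi (opR_bPoly_even _ _)) (opPi_add_opM_add_opR_opM (opR_bPoly_even _ _))⟩

theorem span_rotations_opPi_bPoly (n : ℕ) :
    Submodule.span ℝ (Set.range (Sum.elim
      (fun k : {k : ℕ // 3 * k + 1 ≤ n} => opR (opM (opPi (bPoly n (2 * k)))))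
      (fun k : {k : ℕ // 3 * k + 1 ≤ n} => opM (opR (opPi (bPoly n (2 * k))))))) =
      reflComponent n := by
  rw [Set.Sum.elim_range, Submodule.span_union, range_opR_opM_comp, range_opM_opR_comp]
  apply le_antisymm
  · rw [← range_opR_opM_comp, ← range_opM_opR_comp, ← Submodule.span_union, Submodule.span_le]
    rintro _ (⟨k, rfl⟩ | ⟨k, rfl⟩)
    · exact range_reflMap_opPi_bPoly_le n k (opR_opM_mem_range_reflMap (opPi_add_opM_add_opR_opM (opR_bPoly_even _ _)))
    · refine range_reflMap_opPi_bPoly_le n k ?_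
      beta_reduce
      rw [opR_opPi (opR_bPoly_even n k)]
      exact opM_mem_range_reflMap _
  · refine sSup_le ?_
    rintro E ⟨hEV, hE⟩
    obtain ⟨w, hw, hR, h0, hEw⟩ := hE.exists_generator
    have hH := mem_span_opPi_bPoly (hEV hw) hR (opPi_eq_self hR h0)
    refine hEw.trans ?_
    rintro _ ⟨v, rfl⟩
    -- The coefficients come from eliminating `w = -Mw - RMw` in `v₀ (Mw + w/2) + v₁ w` and using
    -- `MRw = Mw`.
    have h1 : reflMap w v = (opR ∘ₗ opM) ((-v 0 / 2 - v 1) • w) +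
        (opM ∘ₗ opR) ((v 0 / 2 - v 1) • w) := by
      have h2 : opR (opM w) = -w - opM w := by rw [← sub_eq_zero, ← h0]; abel
      simp only [LinearMap.comp_apply, map_smul, hR, h2, reflMap_apply]
      module
    rw [h1]
    exact Submodule.add_mem_sup (Submodule.mem_map_of_mem (Submodule.smul_mem _ _ hH))
      (Submodule.mem_map_of_mem (Submodule.smul_mem _ _ hH))

end TriangleOP

/-- The index set is `0 ≤ k ≤ (n - 1) / 3`, that is `3 k + 1 ≤ n` (empty for `n = 0`). -/
theorem mainTheorem4 (n : ℕ) :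
    LinearIndependent ℝ
      (fun k : {k : ℕ // 3 * k + 1 ≤ n} =>
        TriangleOP.opPi (TriangleOP.bPoly n (2 * k))) ∧
    LinearIndependent ℝ
      (Sum.elim
        (fun k : {k : ℕ // 3 * k + 1 ≤ n} =>
          TriangleOP.opR (TriangleOP.opM (TriangleOP.opPi (TriangleOP.bPoly n (2 * k)))))
        (fun k : {k : ℕ // 3 * k + 1 ≤ n} =>
          TriangleOP.opM (TriangleOP.opR (TriangleOP.opPi (TriangleOP.bPoly n (2 * k)))))) ∧
    Submodule.span ℝ
      (Set.range (Sum.elim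
        (fun k : {k : ℕ // 3 * k + 1 ≤ n} =>
          TriangleOP.opR (TriangleOP.opM (TriangleOP.opPi (TriangleOP.bPoly n (2 * k)))))
        (fun k : {k : ℕ // 3 * k + 1 ≤ n} =>
          TriangleOP.opM (TriangleOP.opR (TriangleOP.opPi (TriangleOP.bPoly n (2 * k))))))) =
      TriangleOP.reflComponent n :=
  ⟨TriangleOP.linearIndependent_opPi_bPoly n,
    TriangleOP.linearIndependent_rotations_opPi_bPoly n,
    TriangleOP.span_rotations_opPi_bPoly n⟩
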